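/- Let $\mathbb{M}_6^+$ be the set of positive-definite symmetric real $6\times 6$ matrices, $I_6$ the identity matrix, $\|A\|_F^2=\mathrm{tr}(A^TA)$, and let $d^SC = 2^{15/2}\prod_{1\le m\le n\le 6} dC_{mn}$ be the volume element on the symmetric $6\times 6$ matrices. Let $0<\delta_c<\sqrt{7/11}$, and put $\sigma_c=\delta_c/\sqrt7$ and $\alpha_m = 1/(2\sigma_c^2)+(1-m)/2$ for $1\le m\le 6$. For $\alpha>0$ let $h(\cdot\,;\alpha)=F_\alpha^{-1}\circ F$, where $F$ is the cumulative distribution function of the standard normal law and $F_\alpha$ that of the Gamma law with shape $\alpha$ and rate $1$, restricted to $[0,\infty)$. For $b\in\mathbb{R}$, a *maximum-entropy density for $b$* is a probability density $p$ with respect to $d^SC$, supported in $\mathbb{M}_6^+$, that maximizes the entropy $-\int p\log p\,d^SC$ among all such densities under which $E\{[C]\}=[I_6]$ and $E\{\log\det[C]\}=b$. A *maximum-entropy field* with constants $b$ and $\delta_c$ is a family, indexed by a parameter $\mathcal S$, of homogeneous (translation-invariant in law) $\mathbb{M}_6^+$-valued random fields $\{[C(x;\mathcal S)],\ x\in\mathbb{R}^3\}$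 such that, for all $x$ and $\mathcal S$, the law of $[C(x;\mathcal S)]$ has a density that is a maximum-entropy density for $b$, and $\delta_c=(E\{\|[C(x;\mathcal S)]-I_6\|_F^2\}/6)^{1/2}$ with a finite expectation. Then $\alpha_1>\dots>\alpha_6>3$; for every $\alpha>0$, $h(\mathcal N;\alpha)$ is a Gamma random variable with parameter $\alpha$ when $\mathcal N$ is standard normal; and the following hold. (i) Let $p([C]) = \mathbf 1_{\mathbb{M}_6^+}([C])\,c_c\,(\det [C])^{7(1-\delta_c^2)/(2\delta_c^2)}\exp(-7\,\mathrm{tr}[C]/(2\delta_c^2))$, with $c_c$ the normalization constant. There is $b_c\in\mathbb{R}$ for which $p$ is a maximum-entropy density, and under $p$ one has $(E\{\|[C]-I_6\|_F^2\}/6)^{1/2}=\delta_c$ and $E\{\|[C]^{-1}\|_F^2\}<\infty$. For every maximum-entropy field with constants $b$ (any real number) and $\delta_c$, and for all $x$ and $\mathcal S$, the law of $[C(x;\mathcal S)]$ is $p([C])\,d^SC$; it depends neither on $x$ nor on $\mathcal S$. (ii) For every such field and all $x$ and $\mathcal S$, one can write $[C(x;\mathcal S)]=[L(x;\mathcal S)]^T[L(x;\mathcal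 S)]$ with $[L(x;\mathcal S)]$ an upper triangular random matrix whose $21$ entries $[L]_{mn}$, $1\le m\le n\le 6$, are mutually independent, with $[L]_{mn}=\sigma_c\,G_{mn}(x;\mathcal S)$ for $m<n$ and $[L]_{mm}=\sigma_c\sqrt{2\,h(G_{mm}(x;\mathcal S);\alpha_m)}$, where the $21$ random variables $G_{mn}(x;\mathcal S)$, $1\le m\le n\le 6$, are independent standard normal. (iii) For each $\mathcal S$ let $\{G(x;\mathcal S),\ x\in\mathbb{R}^3\}$ be a Gaussian, homogeneous, mean-square continuous real-valued random field with $E\{G(x;\mathcal S)\}=0$ and $E\{G(x;\mathcal S)^2\}=1$ for all $x$. Then, on some probability space, there are for each $\mathcal S$ $21$ mutually independent copies $G_{mn}(\cdot;\mathcal S)$, $1\le m\le n\le 6$, of the random field $G(\cdot;\mathcal S)$. For any such independent copies, on any probability space, the formulas of (ii) define a maximum-entropy field $[C(\cdot;\mathcal S)]$ with constants $b_c$ and $\delta_c$, and give its representation as in (ii) for all $x$ and $\mathcal S$. -/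

import Mathlib

open MeasureTheory ProbabilityTheory Filter Topology
open scoped ENNReal

noncomputable section

namespace RandomElasticity

/-- The physical space `ℝ³`. -/
abbrev E3 : Type := EuclideanSpace ℝ (Fin 3)

/-- Real `6 × 6` matrices. -/
abbrev M6 : Type := Matrix (Fin 6) (Fin 6) ℝ

/-- The `21` index pairs `(m, n)` with `m ≤ n` (indices run from `0` to `5`). -/
abbrev UT : Type := {p : Fin 6 × Fin 6 // p.1 ≤ p.2}

/-- The product (entrywise) σ-algebra on `6 × 6` matrices. -/
instance instMeasurableSpaceM6 : MeasurableSpace M6 :=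
  inferInstanceAs (MeasurableSpace (Fin 6 → Fin 6 → ℝ))

/-- The symmetric matrix whose entries on and above the diagonal are given. -/
def symOf (c : UT → ℝ) : M6 :=
  Matrix.of fun m n => c ⟨(min m n, max m n), min_le_max⟩

/-- The volume element `d^S C = 2^{15/2} ∏_{m ≤ n} dC_{mn}` of the symmetric matrices, as a measure
on all matrices that is carried by the symmetric ones. -/
def symVolume : Measure M6 :=
  ENNReal.ofReal ((2 : ℝ) ^ (15 / 2 : ℝ)) • (volume : Measure (UT → ℝ)).map symOf

/-- The squared Frobenius norm `tr (Aᵀ A)`. -/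
def frobSq (A : M6) : ℝ := (A.transpose * A).trace

/-! ### The maximum entropy principle -/

/-- The measure `p(C) d^S C`. -/
def densityLaw (p : M6 → ℝ) : Measure M6 :=
  symVolume.withDensity fun C => ENNReal.ofReal (p C)

/-- `p` is a probability density with respect to `d^S C`, supported in the positive definite
symmetric matrices, under which `E [C] = I₆` and `E log det [C] = b`. -/
structure IsAdmissibleDensity (b : ℝ) (p : M6 → ℝ) : Prop where
  measurable : Measurable p
  nonneg : ∀ C, 0 ≤ p C
  support : ∀ C, ¬ C.PosDef → p C = 0
  prob : IsProbabilityMeasure (densityLaw p)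
  mean_integrable : ∀ m n, Integrable (fun C : M6 => C m n) (densityLaw p)
  mean : ∀ m n, ∫ C : M6, C m n ∂(densityLaw p) = (1 : M6) m n
  logdet_integrable : Integrable (fun C : M6 => Real.log C.det) (densityLaw p)
  logdet : ∫ C : M6, Real.log C.det ∂(densityLaw p) = b

/-- The differential entropy `- ∫ p log p d^S C` of a density, with values in `[-∞, ∞]`: the integral
of the positive part of `- p log p` minus the integral of its negative part. -/
def entropy (p : M6 → ℝ) : EReal :=
  ((∫⁻ C, ENNReal.ofReal (Real.negMulLog (p C)) ∂symVolume : ℝ≥0∞) : EReal)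
    - ((∫⁻ C, ENNReal.ofReal (- Real.negMulLog (p C)) ∂symVolume : ℝ≥0∞) : EReal)

/-- `p` has maximal entropy among all densities under which `E [C] = I₆`, `E log det [C] = b`. -/
def IsMaxEntDensity (b : ℝ) (p : M6 → ℝ) : Prop :=
  IsAdmissibleDensity b p ∧ ∀ q, IsAdmissibleDensity b q → entropy q ≤ entropy p

/-- The random matrix `X` is of second order around `I₆`, and
`δ = (E ‖X - I₆‖_F² / 6)^{1/2}`. -/
def HasFluctuationLevel {Ω : Type*} [MeasurableSpace Ω] (P : Measure Ω) (X : Ω → M6) (δ : ℝ) :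
    Prop :=
  Integrable (fun ω => frobSq (X ω - 1)) P ∧
    δ = Real.sqrt ((∫ ω, frobSq (X ω - 1) ∂P) / 6)

/-! ### Random fields -/

/-- A random field indexed by `ℝ³` is homogeneous: its law (on the product σ-algebra, that is,
its system of finite-dimensional laws) is invariant under translations. -/
def IsHomogeneous {Ω E : Type*} [MeasurableSpace Ω] [MeasurableSpace E] (P : Measure Ω)
    (X : E3 → Ω → E) : Prop :=
  ∀ t : E3, IdentDistrib (fun ω x => X (x + t) ω) (fun ω x => X x ω) P P

/-- A normalized Gaussian homogeneous mean-square continuous real random field on `ℝ³`. -/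
structure IsNormalizedGaussianField {Ω : Type*} [MeasurableSpace Ω] (P : Measure Ω)
    (G : E3 → Ω → ℝ) : Prop where
  measurable : ∀ x, Measurable (G x)
  gaussian : IsGaussianProcess G P
  homogeneous : IsHomogeneous P G
  continuous : ∀ x, Tendsto (fun y => ∫ ω, (G y ω - G x ω) ^ 2 ∂P) (𝓝 x) (𝓝 0)
  mean : ∀ x, ∫ ω, G x ω ∂P = 0
  second_moment : ∀ x, ∫ ω, (G x ω) ^ 2 ∂P = 1

/-- The fields `G i`, on the probability space `(Ω, P)`, are mutually independent copies (as random
fields) of the field `G₀`, which lives on `(Ω₀, P₀)`. -/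
structure AreIndependentCopies {Ω Ω₀ ι : Type*} [MeasurableSpace Ω] [MeasurableSpace Ω₀]
    (P : Measure Ω) (P₀ : Measure Ω₀) (G : ι → E3 → Ω → ℝ) (G₀ : E3 → Ω₀ → ℝ) : Prop where
  measurable : ∀ i x, Measurable (G i x)
  copies : ∀ i, IdentDistrib (fun ω x => G i x ω) (fun ω x => G₀ x ω) P P₀
  indep : iIndepFun (fun i ω x => G i x ω) P

/-- A family, indexed by the parameter `s : S`, of homogeneous random fields on `ℝ³` with values in
the positive definite symmetric matrices, whose value at each point has been obtained by the
maximum entropy principle under `E [C(x;s)] = I₆`, `E log det [C(x;s)] = b`, and has the level of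
fluctuations `δ`; `b` and `δ` depend neither on `x` nor on `s`. -/
structure IsMaxEntField {Ω S : Type*} [MeasurableSpace Ω] (P : Measure Ω) (b δ : ℝ)
    (C : S → E3 → Ω → M6) : Prop where
  measurable : ∀ s x, Measurable (C s x)
  posDef : ∀ s x ω, (C s x ω).PosDef
  homogeneous : ∀ s, IsHomogeneous P (C s)
  maxEnt : ∀ s x, ∃ p, IsMaxEntDensity b p ∧ P.map (C s x) = densityLaw p
  level : ∀ s x, HasFluctuationLevel P (C s x) δ

/-! ### The explicit density and the triangular factor -/

/-- `1_{M₆⁺}(C) (det C)^{7(1-δ²)/(2δ²)} exp(-7 tr C/(2δ²))`. -/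
def unnormalizedPdf (δ : ℝ) : M6 → ℝ :=
  Set.indicator {C : M6 | C.PosDef} fun C =>
    C.det ^ (7 * (1 - δ ^ 2) / (2 * δ ^ 2)) * Real.exp (-(7 * C.trace / (2 * δ ^ 2)))

/-- The normalization constant. -/
def normConst (δ : ℝ) : ℝ := (∫ C, unnormalizedPdf δ C ∂symVolume)⁻¹

/-- The normalized density. -/
def pdfC (δ : ℝ) (C : M6) : ℝ := normConst δ * unnormalizedPdf δ C

/-- `σ = δ / √7`. -/
def sigmaC (δ : ℝ) : ℝ := δ / Real.sqrt 7

/-- `α_m = 1/(2σ²) + (1-m)/2`, where the index `m` of the formula is `m + 1` here. -/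
def alphaC (δ : ℝ) (m : Fin 6) : ℝ :=
  1 / (2 * sigmaC δ ^ 2) + (1 - ((m : ℕ) + 1 : ℝ)) / 2

/-- `h(b; α) = F_α⁻¹(F(b))`, where `F` is the cumulative distribution function of the standard
normal law and `F_α⁻¹` is the reciprocal function of the restriction to `[0, ∞)` of the cumulative
distribution function of the Gamma law with parameter `α` (and unit rate). -/
def hFun (α b : ℝ) : ℝ :=
  Function.invFunOn (cdf (gammaMeasure α 1)) (Set.Ici 0) (cdf (gaussianReal 0 1) b)

/-- The upper triangular matrix with entries `σ g_{mn}` above the diagonal and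
`σ √(2 h(g_{mm}; α_m))` on the diagonal. -/
def upperFactor (δ : ℝ) (g : UT → ℝ) : M6 :=
  Matrix.of fun m n =>
    if hmn : m < n then sigmaC δ * g ⟨(m, n), hmn.le⟩
    else if m = n then sigmaC δ * Real.sqrt (2 * hFun (alphaC δ m) (g ⟨(m, m), le_rfl⟩))
    else 0

/-- The random matrix `X` is `Lᵀ L` with `L` upper triangular, with `21` independent entries
`L_{mn} = σ G_{mn}` for `m < n` and `L_{mm} = σ √(2 h(G_{mm}; α_m))`, where the `G_{mn}` are
independent standard normal random variables. -/
structure IsTriangularRepresentation {Ω : Type*} [MeasurableSpace Ω] (P : Measure Ω) (δ : ℝ)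
    (X : Ω → M6) (L : Ω → M6) (G : UT → Ω → ℝ) : Prop where
  factorization : ∀ ω, X ω = (L ω).transpose * L ω
  measurable : Measurable L
  upper : ∀ ω m n, n < m → L ω m n = 0
  indep : iIndepFun (fun (i : UT) ω => L ω i.1.1 i.1.2) P
  off_diagonal : ∀ (m n : Fin 6) (hmn : m < n) ω, L ω m n = sigmaC δ * G ⟨(m, n), hmn.le⟩ ω
  diagonal : ∀ (m : Fin 6) ω,
    L ω m m = sigmaC δ * Real.sqrt (2 * hFun (alphaC δ m) (G ⟨(m, m), le_rfl⟩ ω))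
  gaussian_measurable : ∀ i, Measurable (G i)
  gaussian : ∀ i, HasLaw (G i) (gaussianReal 0 1) P
  gaussian_indep : iIndepFun G P

end RandomElasticity

end

open RandomElasticity

universe u v w

noncomputable section

namespace RandomElasticity

/-! ### Cumulative distribution functions and the function `h` -/

/-! Three mechanisms carry the proof.

The first is the Bartlett decomposition. The map `L ↦ Lᵀ L` is a bijection from upper triangular
matrices with positive diagonal onto positive definite matrices (`exists_gram_eq`,
`injOn_gramUpper`). Its Jacobian is a monomial in the diagonal entries (`det_gramDeriv`). Since `det
(Lᵀ L)` is the product of the squared diagonal entries and `tr (Lᵀ L)` is the sum of all squared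
entries, the explicit density pulls back to a product of one-dimensional densities
(`prod_entryPDF`): centred normal above the diagonal, scaled square root of a Gamma variable on it.
The quantile transform `hFun` produces the latter from normals, so `map_gramFactor` writes the
explicit law as the image of 21 independent standard normals, and all moments are computed on the
triangular side.

The second is the Gibbs inequality. The logarithm of the explicit density is affine in `log det` and
the trace, so its mean is the same under every admissible density (`integral_logPdf`). With `log t ≤
t - 1` this gives maximality, and the equality case gives uniqueness
(`densityLaw_eq_of_isMaxEntDensity`).

The third identifies the law when the constant `b` of a field is arbitrary. Since `log det C ≤ tr C
- 6` with equality only at the identity, a positive fluctuation level forces `b < 0` (`logdet_neg`).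
Each negative `b` is the log-determinant mean of the explicit density for some `δ'`
(`exists_logDetMean_eq`). Uniqueness identifies the law as the one for `δ'`, whose level is `δ'`, so
`δ' = δ`.

For fields, `gramFactor` is a measurable embedding with range the positive definite matrices. Its
inverse yields the normals on the given probability space; conversely, applying it pointwise to
independent homogeneous fields preserves homogeneity. -/

lemma continuous_cdf (μ : Measure ℝ) [IsProbabilityMeasure μ] (hμ : ∀ x, μ {x} = 0) :
    Continuous (cdf μ) := by
  rw [continuous_iff_continuousAt]
  intro x
  rw [(monotone_cdf μ).continuousAt_iff_leftLim_eq_rightLim, StieltjesFunction.rightLim_eq]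
  have h := StieltjesFunction.measure_singleton (cdf μ) x
  rw [measure_cdf, hμ, eq_comm, ENNReal.ofReal_eq_zero] at h
  exact le_antisymm ((monotone_cdf μ).leftLim_le le_rfl) (by linarith)

lemma cdf_lt_cdf {μ : Measure ℝ} [IsProbabilityMeasure μ] {x y : ℝ}
    (h : μ (Set.Ioc x y) ≠ 0) : cdf μ x < cdf μ y := by
  rw [← measure_cdf μ, StieltjesFunction.measure_Ioc] at h
  simpa using h

lemma gammaMeasure_singleton (α x : ℝ) : gammaMeasure α 1 {x} = 0 :=
  withDensity_absolutelyContinuous _ _ (by simp)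

lemma gaussianReal_singleton (x : ℝ) : gaussianReal 0 1 {x} = 0 :=
  gaussianReal_absolutelyContinuous 0 one_ne_zero (by simp)

lemma strictMono_cdf_gaussianReal : StrictMono (cdf (gaussianReal 0 1)) := by
  intro x y hxy
  refine cdf_lt_cdf fun h => ?_
  have := gaussianReal_absolutelyContinuous' 0 one_ne_zero h
  simp at this
  linarith

lemma cdf_gaussianReal_mem (x : ℝ) : cdf (gaussianReal 0 1) x ∈ Set.Ioo 0 1 := by
  constructor
  · exact (cdf_nonneg _ (x - 1)).trans_lt (strictMono_cdf_gaussianReal (by linarith))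
  · exact (strictMono_cdf_gaussianReal (by linarith)).trans_le (cdf_le_one _ (x + 1))

lemma gammaMeasure_Iic_zero (α : ℝ) : gammaMeasure α 1 (Set.Iic 0) = 0 := by
  rw [← Set.Iio_union_right, measure_union_null_iff]
  refine ⟨?_, gammaMeasure_singleton α 0⟩
  rw [gammaMeasure, withDensity_apply _ measurableSet_Iio]
  exact lintegral_gammaPDF_of_nonpos le_rfl

lemma cdf_gammaMeasure_of_nonpos {α : ℝ} (hα : 0 < α) {x : ℝ} (hx : x ≤ 0) :
    cdf (gammaMeasure α 1) x = 0 := by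
  have := isProbabilityMeasure_gammaMeasure hα one_pos
  rw [cdf_eq_real, measureReal_def,
    measure_mono_null (Set.Iic_subset_Iic.2 hx) (gammaMeasure_Iic_zero α)]
  simp

/-- The density is positive on `(0, ∞)`, so an interval with left end in `[0, ∞)` and zero mass
would be Lebesgue null. -/
lemma strictMonoOn_cdf_gammaMeasure {α : ℝ} (hα : 0 < α) :
    StrictMonoOn (cdf (gammaMeasure α 1)) (Set.Ici 0) := by
  have := isProbabilityMeasure_gammaMeasure hα one_pos
  intro x hx y _ hxy
  refine cdf_lt_cdf fun h => ?_
  have hx : 0 ≤ x := hx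
  rw [gammaMeasure, withDensity_apply _ measurableSet_Ioc,
    lintegral_eq_zero_iff (by unfold gammaPDF; fun_prop), EventuallyEq,
    ae_restrict_iff' measurableSet_Ioc] at h
  have h2 : volume (Set.Ioc x y) = 0 := by
    refine measure_mono_null ?_ h
    intro t ht
    have h3 : 0 < gammaPDFReal α 1 t := gammaPDFReal_pos hα one_pos (hx.trans_lt ht.1)
    simp [gammaPDF, ht.1, ht.2, h3]
  simp at h2
  linarith

lemma exists_cdf_gammaMeasure_eq {α : ℝ} (hα : 0 < α) {p : ℝ} (hp : p ∈ Set.Ioo (0 : ℝ) 1) :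
    ∃ y, 0 ≤ y ∧ cdf (gammaMeasure α 1) y = p := by
  have := isProbabilityMeasure_gammaMeasure hα one_pos
  have hc := continuous_cdf _ (gammaMeasure_singleton α)
  obtain ⟨M, hM⟩ := ((tendsto_cdf_atTop (gammaMeasure α 1)).eventually (lt_mem_nhds hp.2)).exists
  have h0 := cdf_gammaMeasure_of_nonpos hα le_rfl
  have hM0 : 0 ≤ M := by
    by_contra h
    rw [cdf_gammaMeasure_of_nonpos hα (by linarith)] at hM
    exact absurd hp.1 (by linarith)
  obtain ⟨y, hy, hyp⟩ := intermediate_value_Icc hM0 hc.continuousOn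
    (show p ∈ Set.Icc _ _ from ⟨h0.trans_le hp.1.le, hM.le⟩)
  exact ⟨y, hy.1, hyp⟩

lemma exists_cdf_gaussianReal_eq {p : ℝ} (hp : p ∈ Set.Ioo (0 : ℝ) 1) :
    ∃ y, cdf (gaussianReal 0 1) y = p := by
  have hc := continuous_cdf _ gaussianReal_singleton
  obtain ⟨M, hM⟩ := ((tendsto_cdf_atTop (gaussianReal 0 1)).eventually (lt_mem_nhds hp.2)).exists
  obtain ⟨m, hm⟩ := ((tendsto_cdf_atBot (gaussianReal 0 1)).eventually (gt_mem_nhds hp.1)).exists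
  exact mem_range_of_exists_le_of_exists_ge hc ⟨m, hm.le⟩ ⟨M, hM.le⟩

/-- `Function.invFunOn` is meaningful only at attained values. The normal distribution function
stays strictly between 0 and 1, and the Gamma one attains all such values on `[0, ∞)`. -/
lemma cdf_hFun {α : ℝ} (hα : 0 < α) (b : ℝ) :
    0 ≤ hFun α b ∧ cdf (gammaMeasure α 1) (hFun α b) = cdf (gaussianReal 0 1) b := by
  obtain ⟨y, hy, h⟩ := exists_cdf_gammaMeasure_eq hα (cdf_gaussianReal_mem b)
  exact ⟨Function.invFunOn_mem ⟨y, hy, h⟩, Function.invFunOn_eq ⟨y, hy, h⟩⟩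

lemma hFun_pos {α : ℝ} (hα : 0 < α) (b : ℝ) : 0 < hFun α b := by
  obtain ⟨h0, h⟩ := cdf_hFun hα b
  refine h0.lt_of_ne fun h' => ?_
  rw [← h', cdf_gammaMeasure_of_nonpos hα le_rfl] at h
  exact (cdf_gaussianReal_mem b).1.ne h

lemma strictMono_hFun {α : ℝ} (hα : 0 < α) : StrictMono (hFun α) := by
  intro a b hab
  rw [← (strictMonoOn_cdf_gammaMeasure hα).lt_iff_lt (hFun_pos hα a).le (hFun_pos hα b).le,
    (cdf_hFun hα a).2, (cdf_hFun hα b).2]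
  exact strictMono_cdf_gaussianReal hab

lemma exists_hFun_eq {α : ℝ} (hα : 0 < α) {y : ℝ} (hy : 0 < y) : ∃ b, hFun α b = y := by
  have hmem : cdf (gammaMeasure α 1) y ∈ Set.Ioo (0 : ℝ) 1 := by
    constructor
    · rw [← cdf_gammaMeasure_of_nonpos hα le_rfl]
      exact strictMonoOn_cdf_gammaMeasure hα Set.self_mem_Ici hy.le hy
    · exact (strictMonoOn_cdf_gammaMeasure hα hy.le (show (0 : ℝ) ≤ y + 1 by linarith)
        (lt_add_one y)).trans_le (cdf_le_one _ _)
  obtain ⟨b, hb⟩ := exists_cdf_gaussianReal_eq hmem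
  refine ⟨b, (strictMonoOn_cdf_gammaMeasure hα).injOn (hFun_pos hα b).le hy.le ?_⟩
  rw [(cdf_hFun hα b).2, hb]

lemma measurable_hFun {α : ℝ} (hα : 0 < α) : Measurable (hFun α) :=
  (strictMono_hFun hα).monotone.measurable

/-- Inverse transform sampling: for `y = hFun α z`, monotonicity turns the event `hFun α ≤ y` into
`Iic z`, and the two distribution functions agree by the choice of `hFun`. -/
lemma hasLaw_hFun {α : ℝ} (hα : 0 < α) :
    HasLaw (hFun α) (gammaMeasure α 1) (gaussianReal 0 1) := by
  have := isProbabilityMeasure_gammaMeasure hα one_pos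
  refine ⟨(measurable_hFun hα).aemeasurable, ?_⟩
  have := Measure.isProbabilityMeasure_map (μ := gaussianReal 0 1) (measurable_hFun hα).aemeasurable
  refine Measure.ext_of_Iic _ _ fun y => ?_
  rw [Measure.map_apply (measurable_hFun hα) measurableSet_Iic]
  rcases le_or_gt y 0 with hy | hy
  · rw [measure_mono_null (Set.Iic_subset_Iic.2 hy) (gammaMeasure_Iic_zero α)]
    convert measure_empty (μ := gaussianReal 0 1)
    ext b
    simpa using hy.trans_lt (hFun_pos hα b)
  · obtain ⟨z, rfl⟩ := exists_hFun_eq hα hy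
    have : hFun α ⁻¹' Set.Iic (hFun α z) = Set.Iic z := by
      ext b
      simp [(strictMono_hFun hα).le_iff_le]
    rw [this, ← ofReal_cdf, ← ofReal_cdf, (cdf_hFun hα z).2]

/-! ### The Cholesky factorization -/

/-- The diagonal index `(m, m)`. -/
def diagIdx (m : Fin 6) : UT := ⟨(m, m), le_rfl⟩

/-- The upper triangular matrix with given entries on and above the diagonal. -/
def upperMat (l : UT → ℝ) : M6 :=
  Matrix.of fun m n => if h : m ≤ n then l ⟨(m, n), h⟩ else 0

lemma upperMat_of_le (l : UT → ℝ) {m n : Fin 6} (h : m ≤ n) : upperMat l m n = l ⟨(m, n), h⟩ := by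
  simp [upperMat, h]

lemma upperMat_of_lt (l : UT → ℝ) {m n : Fin 6} (h : n < m) : upperMat l m n = 0 := by
  simp [upperMat, not_le.2 h]

lemma upperMat_self (l : UT → ℝ) (m : Fin 6) : upperMat l m m = l (diagIdx m) :=
  upperMat_of_le l le_rfl

lemma det_upperMat (l : UT → ℝ) : (upperMat l).det = ∏ m, l (diagIdx m) := by
  rw [Matrix.det_of_isUpperTriangular]
  · exact Finset.prod_congr rfl fun m _ => upperMat_self l m
  · intro m n h
    exact upperMat_of_lt l h

/-- The arrays of entries of upper triangular matrices with positive diagonal. -/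
def cholCone : Set (UT → ℝ) := {l | ∀ m, 0 < l (diagIdx m)}

/-- The entries on and above the diagonal of `Lᵀ L`. -/
def gramUpper (l : UT → ℝ) : UT → ℝ := fun p => ∑ k, upperMat l k p.1.1 * upperMat l k p.1.2

lemma symOf_gramUpper (l : UT → ℝ) :
    symOf (gramUpper l) = (upperMat l).transpose * upperMat l := by
  ext m n
  simp only [symOf, gramUpper, Matrix.of_apply, Matrix.mul_apply, Matrix.transpose_apply]
  refine Finset.sum_congr rfl fun k _ => ?_
  rcases le_total m n with h | h
  · rw [min_eq_left h, max_eq_right h]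
  · rw [min_eq_right h, max_eq_left h, mul_comm]

lemma symOf_apply (c : UT → ℝ) (p : UT) : symOf c p.1.1 p.1.2 = c p := by
  obtain ⟨⟨m, n⟩, h⟩ := p
  simp [symOf, min_eq_left h, max_eq_right h]

lemma symOf_injective : Function.Injective symOf := by
  intro c d h
  ext p
  rw [← symOf_apply c, h, symOf_apply]

lemma measurable_entry (m n : Fin 6) : Measurable fun C : M6 => C m n :=
  (measurable_pi_apply n).comp (measurable_pi_apply (X := fun _ : Fin 6 => Fin 6 → ℝ) m)

lemma measurable_of_entries {Ω : Type*} [MeasurableSpace Ω] {f : Ω → M6}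
    (h : ∀ m n, Measurable fun ω => f ω m n) : Measurable f :=
  measurable_pi_lambda (X := fun _ : Fin 6 => Fin 6 → ℝ) f
    fun m => measurable_pi_lambda _ fun n => h m n

lemma measurable_symOf : Measurable symOf :=
  measurable_of_entries fun _ _ => measurable_pi_apply _

lemma measurableEmbedding_symOf : MeasurableEmbedding symOf := by
  have : MeasurableSpace.CountablySeparated M6 :=
    inferInstanceAs (MeasurableSpace.CountablySeparated (Fin 6 → Fin 6 → ℝ))
  exact measurable_symOf.measurableEmbedding symOf_injective

lemma det_gram (l : UT → ℝ) :
    ((upperMat l).transpose * upperMat l).det = ∏ m, l (diagIdx m) ^ 2 := by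
  rw [Matrix.det_mul, Matrix.det_transpose, det_upperMat, ← sq, Finset.prod_pow]

lemma posDef_gram {l : UT → ℝ} (hl : l ∈ cholCone) :
    ((upperMat l).transpose * upperMat l).PosDef := by
  rw [← Matrix.conjTranspose_eq_transpose_of_trivial]
  refine Matrix.PosDef.conjTranspose_mul_self _ ?_
  rw [Matrix.mulVec_injective_iff_isUnit, Matrix.isUnit_iff_isUnit_det, det_upperMat,
    isUnit_iff_ne_zero]
  exact (Finset.prod_pos fun m _ => hl m).ne'

/-- Cholesky from LDL: the factor is `√D` times the transpose of the lower factor, up to the signs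
of its rows. -/
lemma exists_gram_eq {C : M6} (hC : C.PosDef) :
    ∃ l ∈ cholCone, (upperMat l).transpose * upperMat l = C := by
  set D := LDL.diagEntries hC with hD
  have hDnn : ∀ m, 0 ≤ D m := by
    intro m
    have h1 : (LDL.diag hC).PosSemidef := by
      rw [LDL.diag_eq_lowerInv_conj]
      exact hC.posSemidef.mul_mul_conjTranspose_same _
    have := h1.diag_nonneg (i := m)
    simpa [LDL.diag] using this
  set U : M6 := Matrix.diagonal (fun m => Real.sqrt (D m)) * (LDL.lower hC).transpose with hU
  have hUC : U.transpose * U = C := by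
    conv_rhs => rw [← LDL.lower_conj_diag hC]
    rw [hU, Matrix.transpose_mul, Matrix.diagonal_transpose, Matrix.transpose_transpose,
      Matrix.conjTranspose_eq_transpose_of_trivial, Matrix.mul_assoc, Matrix.mul_assoc,
      ← Matrix.mul_assoc (Matrix.diagonal _), Matrix.diagonal_mul_diagonal, LDL.diag]
    simp_rw [Real.mul_self_sqrt (hDnn _)]
    rfl
  have hlow : ∀ m n, m < n → LDL.lower hC m n = 0 := by
    have h1 : (LDL.lowerInv hC).IsLowerTriangular := fun m n h => LDL.lowerInv_triangular hC h
    exact fun m n h => Matrix.blockTriangular_inv_of_blockTriangular h1 h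
  have hUtri : ∀ m n, n < m → U m n = 0 := by
    intro m n h
    rw [hU, Matrix.diagonal_mul, Matrix.transpose_apply, hlow n m h, mul_zero]
  have hUdet : U.det ≠ 0 := by
    have := hC.det_pos
    rw [← hUC, Matrix.det_mul, Matrix.det_transpose] at this
    exact fun h => by simp [h] at this
  have hUdiag : ∀ m, U m m ≠ 0 := by
    rw [Matrix.det_of_isUpperTriangular (fun m n h => hUtri m n h), Finset.prod_ne_zero_iff] at hUdet
    exact fun m => hUdet m (Finset.mem_univ _)
  -- The diagonal of `U` is only known to be nonzero. Multiplying each row by the sign of its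
  -- diagonal entry makes the diagonal positive and leaves `Uᵀ U` unchanged, as the signs square to
  -- 1.
  refine ⟨fun p => SignType.sign (U p.1.1 p.1.1) * U p.1.1 p.1.2, ?_, ?_⟩
  · intro m
    simp only [diagIdx, sign_mul_self]
    exact abs_pos.2 (hUdiag m)
  · rw [← hUC]
    ext m n
    simp only [Matrix.mul_apply, Matrix.transpose_apply]
    refine Finset.sum_congr rfl fun k _ => ?_
    have h1 : ∀ n, upperMat (fun p => SignType.sign (U p.1.1 p.1.1) * U p.1.1 p.1.2) k n =
        SignType.sign (U k k) * U k n := by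
      intro n
      rcases le_or_gt k n with h | h
      · rw [upperMat_of_le _ h]
      · rw [upperMat_of_lt _ h, hUtri _ _ h, mul_zero]
    have h2 : (SignType.sign (U k k) : ℝ) * SignType.sign (U k k) = 1 := by
      rcases (hUdiag k).lt_or_gt with h | h <;> simp [h]
    rw [h1, h1]
    linear_combination (U k m * U k n) * h2

/-- Triangularity kills the rows below `p.1.1`, leaving one term with the entry `l p` and a sum over
earlier rows. This is the recursion that solves for `L` row by row. -/
lemma gramUpper_apply (l : UT → ℝ) (p : UT) :
    gramUpper l p = upperMat l p.1.1 p.1.1 * l p +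
      ∑ k ∈ Finset.Iio p.1.1, upperMat l k p.1.1 * upperMat l k p.1.2 := by
  rw [gramUpper, ← Finset.sum_subset (Finset.subset_univ (Finset.Iic p.1.1)),
    ← Finset.Iio_insert, Finset.sum_insert (by simp), upperMat_of_le l p.2]
  intro k _ hk
  rw [upperMat_of_lt l (by simpa using hk), zero_mul]

/-- Induction on the row: with earlier rows known, the diagonal entry is determined by its square
and its sign, and the rest of the row by division by it. -/
lemma injOn_gramUpper : Set.InjOn gramUpper cholCone := by
  intro l hl l' hl' h
  have key : ∀ m : Fin 6, ∀ n, upperMat l m n = upperMat l' m n := by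
    intro m
    induction m using WellFoundedLT.induction with
    | ind m ih =>
      have hsum : ∀ n, ∑ k ∈ Finset.Iio m, upperMat l k m * upperMat l k n =
          ∑ k ∈ Finset.Iio m, upperMat l' k m * upperMat l' k n :=
        fun n => Finset.sum_congr rfl fun k hk => by
          rw [ih k (by simpa using hk), ih k (by simpa using hk)]
      have hent : ∀ n (hmn : m ≤ n), upperMat l m m * upperMat l m n =
          upperMat l' m m * upperMat l' m n := by
        intro n hmn
        have h1 := congrFun h ⟨(m, n), hmn⟩
        rw [gramUpper_apply, gramUpper_apply] at h1
        simp only [hsum n, add_left_inj] at h1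
        rw [upperMat_of_le l hmn, upperMat_of_le l' hmn]
        exact h1
      have hd : upperMat l m m = upperMat l' m m := by
        have := hent m le_rfl
        rw [← sq, ← sq] at this
        rw [upperMat_self, upperMat_self] at this ⊢
        exact (pow_left_inj₀ (hl m).le (hl' m).le two_ne_zero).1 this
      intro n
      rcases le_or_gt m n with hmn | hmn
      · have := hent n hmn
        rw [hd] at this
        refine mul_left_cancel₀ ?_ this
        rw [upperMat_self]
        exact (hl' m).ne'
      · rw [upperMat_of_lt _ hmn, upperMat_of_lt _ hmn]
  ext p
  have := key p.1.1 p.1.2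
  rwa [upperMat_of_le l p.2, upperMat_of_le l' p.2] at this

lemma image_gramUpper : gramUpper '' cholCone = symOf ⁻¹' {C | C.PosDef} := by
  ext c
  constructor
  · rintro ⟨l, hl, rfl⟩
    simpa [symOf_gramUpper] using posDef_gram hl
  · intro hc
    obtain ⟨l, hl, h⟩ := exists_gram_eq hc
    exact ⟨l, hl, symOf_injective (by rw [symOf_gramUpper, h])⟩

lemma measurableSet_cholCone : MeasurableSet cholCone := by
  have : cholCone = ⋂ m, {l | 0 < l (diagIdx m)} := by ext; simp [cholCone]
  rw [this]
  exact MeasurableSet.iInter fun m => measurableSet_lt measurable_const (measurable_pi_apply _)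

lemma measurable_upperMat (m n : Fin 6) : Measurable fun l => upperMat l m n := by
  rcases le_or_gt m n with h | h
  · simpa only [upperMat_of_le _ h] using measurable_pi_apply _
  · simpa only [upperMat_of_lt _ h] using measurable_const

lemma measurable_gramUpper : Measurable gramUpper :=
  measurable_pi_lambda _ fun p =>
    Finset.measurable_sum _ fun k _ => (measurable_upperMat _ _).mul (measurable_upperMat _ _)

/-- By Lusin–Souslin, the injective measurable image of the Borel set `cholCone` is measurable. -/
lemma measurableSet_posDef : MeasurableSet {C : M6 | C.PosDef} := by
  have : {C : M6 | C.PosDef} = (symOf ∘ gramUpper) '' cholCone := by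
    ext C
    constructor
    · intro hC
      obtain ⟨l, hl, h⟩ := exists_gram_eq hC
      exact ⟨l, hl, by simp [symOf_gramUpper, h]⟩
    · rintro ⟨l, hl, rfl⟩
      simpa [symOf_gramUpper] using posDef_gram hl
  rw [this]
  have : MeasurableSpace.CountablySeparated M6 :=
    inferInstanceAs (MeasurableSpace.CountablySeparated (Fin 6 → Fin 6 → ℝ))
  exact measurableSet_cholCone.image_of_measurable_injOn
    (measurable_symOf.comp measurable_gramUpper)
    (symOf_injective.comp_injOn injOn_gramUpper)

/-! ### The Jacobian of the Cholesky parametrization -/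

/-- The linear form `l ↦ L_{kn}`, where `L` is the upper triangular matrix with entries `l`. -/
def upperProj (k n : Fin 6) : (UT → ℝ) →L[ℝ] ℝ :=
  if h : k ≤ n then ContinuousLinearMap.proj ⟨(k, n), h⟩ else 0

lemma upperProj_apply (k n : Fin 6) (l : UT → ℝ) : upperProj k n l = upperMat l k n := by
  rcases le_or_gt k n with h | h
  · simp [upperProj, upperMat, h]
  · simp [upperProj, upperMat, not_le.2 h]

/-- The derivative of `gramUpper`. -/
def gramDeriv (l : UT → ℝ) : (UT → ℝ) →L[ℝ] (UT → ℝ) :=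
  ContinuousLinearMap.pi fun p => ∑ k, (upperMat l k p.1.1 • upperProj k p.1.2 +
    upperMat l k p.1.2 • upperProj k p.1.1)

lemma hasFDerivAt_gramUpper (l : UT → ℝ) : HasFDerivAt gramUpper (gramDeriv l) l := by
  refine hasFDerivAt_pi.2 fun p => ?_
  have h : (fun l => gramUpper l p) =
      fun l => ∑ k, upperProj k p.1.1 l * upperProj k p.1.2 l := by
    ext l
    simp only [gramUpper, upperProj_apply]
  rw [h]
  refine HasFDerivAt.fun_sum fun k _ => ?_
  have := (upperProj k p.1.1).hasFDerivAt (x := l) |>.mul ((upperProj k p.1.2).hasFDerivAt (x := l))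
  rw [upperProj_apply, upperProj_apply] at this
  exact this

lemma upperMat_single (q : UT) (k n : Fin 6) :
    upperMat (Pi.single q 1) k n = if q.1 = (k, n) then 1 else 0 := by
  rcases le_or_gt k n with h | h
  · rw [upperMat_of_le _ h, Pi.single_apply]
    congr 1
    rw [Subtype.ext_iff, eq_comm (a := q.1)]
  · rw [upperMat_of_lt _ h, if_neg]
    intro h'
    have := q.2
    rw [h'] at this
    exact absurd this (not_le.2 h)

lemma gramDeriv_single (l : UT → ℝ) (p q : UT) :
    gramDeriv l (Pi.single q 1) p = (if q.1.2 = p.1.2 then upperMat l q.1.1 p.1.1 else 0) +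
      if q.1.2 = p.1.1 then upperMat l q.1.1 p.1.2 else 0 := by
  simp only [gramDeriv, ContinuousLinearMap.coe_pi', FunLike.coe_sum,
    Finset.sum_apply, add_apply, smul_apply, smul_eq_mul,
    upperProj_apply, upperMat_single, Prod.ext_iff, Finset.sum_add_distrib]
  congr 1
  · rw [Finset.sum_eq_single q.1.1]
    · simp
    · intro k _ hk
      simp [Ne.symm hk]
    · simp
  · rw [Finset.sum_eq_single q.1.1]
    · simp
    · intro k _ hk
      simp [Ne.symm hk]
    · simp

/-- In the lexicographic order of the index pairs, the entry `p` of `Lᵀ L` does not involve any `l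
q` with `q` after `p`, so the Jacobian matrix is lower triangular. The factor 2 comes from the
squares on the diagonal. -/
lemma det_gramDeriv (l : UT → ℝ) :
    (gramDeriv l).det = ∏ p : UT, l (diagIdx p.1.1) * if p.1.1 = p.1.2 then 2 else 1 := by
  have hinj : Function.Injective fun p : UT => toLex p.1 :=
    fun p q h => Subtype.ext (toLex.injective h)
  rw [ContinuousLinearMap.det, ← LinearMap.det_toMatrix',
    @Matrix.det_of_isLowerTriangular UT ℝ _ _ _ (LinearOrder.lift' _ hinj)]
  · refine Finset.prod_congr rfl fun p _ => ?_
    rw [LinearMap.toMatrix'_apply]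
    have h := gramDeriv_single l p p
    simp only [ContinuousLinearMap.coe_coe]
    rw [h, upperMat_self, if_pos rfl]
    by_cases hp : p.1.1 = p.1.2
    · rw [if_pos hp.symm, if_pos hp, ← hp, upperMat_self]
      ring
    · rw [if_neg (Ne.symm hp), if_neg hp]
      ring
  · intro p q hpq
    have hlt : toLex p.1 < toLex q.1 := hpq
    rw [LinearMap.toMatrix'_apply]
    simp only [ContinuousLinearMap.coe_coe]
    rw [gramDeriv_single]
    rw [Prod.Lex.toLex_lt_toLex] at hlt
    have hq := q.2
    have hp := p.2
    rcases hlt with h | ⟨h1, h2⟩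
    · rw [upperMat_of_lt l h]
      simp only [ite_self, zero_add, ite_eq_right_iff]
      intro h3
      exact absurd (hq.trans_eq h3) (not_le.2 h)
    · rw [if_neg h2.ne', if_neg, add_zero]
      exact fun h3 => absurd (hp.trans_lt h2) (by rw [h3]; exact lt_irrefl _)

/-! ### Products over index pairs -/

lemma prod_UT {M : Type*} [CommMonoid M] (F : Fin 6 → Fin 6 → M) :
    ∏ p : UT, F p.1.1 p.1.2 = ∏ m, ∏ n, if m ≤ n then F m n else 1 := by
  rw [← Fintype.prod_prod_type' (f := fun m n => if m ≤ n then F m n else 1),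
    ← Finset.prod_filter (fun q : Fin 6 × Fin 6 => q.1 ≤ q.2) (fun q => F q.1 q.2),
    Finset.prod_subtype (p := fun q : Fin 6 × Fin 6 => q.1 ≤ q.2) _ (by simp)]

lemma sum_UT {M : Type*} [AddCommMonoid M] (F : Fin 6 → Fin 6 → M) :
    ∑ p : UT, F p.1.1 p.1.2 = ∑ m, ∑ n, if m ≤ n then F m n else 0 :=
  prod_UT (M := Multiplicative M) F

lemma prod_UT_diag {M : Type*} [CommMonoid M] (f : Fin 6 → M) :
    ∏ p : UT, (if p.1.1 = p.1.2 then f p.1.1 else 1) = ∏ m, f m := by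
  rw [prod_UT fun m n => if m = n then f m else 1]
  refine Finset.prod_congr rfl fun m _ => ?_
  rw [Finset.prod_eq_single m]
  · simp
  · intro n _ hn
    simp [Ne.symm hn]
  · simp

lemma prod_UT_fst {M : Type*} [CommMonoid M] (f : Fin 6 → M) :
    ∏ p : UT, f p.1.1 = ∏ m, f m ^ (6 - (m : ℕ)) := by
  rw [prod_UT fun m _ => f m]
  refine Finset.prod_congr rfl fun m _ => ?_
  rw [← Finset.prod_filter, Finset.prod_const]
  congr 1
  revert m
  decide

lemma trace_gram (l : UT → ℝ) :
    ((upperMat l).transpose * upperMat l).trace = ∑ p, l p ^ 2 := by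
  have h : ∀ p : UT, l p ^ 2 = upperMat l p.1.1 p.1.2 ^ 2 := fun p => by
    rw [upperMat_of_le l p.2]
  simp_rw [h]
  rw [sum_UT fun m n => upperMat l m n ^ 2, Matrix.trace, Finset.sum_comm]
  refine Finset.sum_congr rfl fun n _ => ?_
  rw [Matrix.diag_apply, Matrix.mul_apply]
  refine Finset.sum_congr rfl fun m _ => ?_
  rw [Matrix.transpose_apply, ← sq]
  split_ifs with h
  · rfl
  · rw [upperMat_of_lt l (not_le.1 h)]
    simp

/-! ### The laws of the entries of the triangular factor -/

/-- The rate `1/(2σ²) = 7/(2δ²)`. -/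
def rate (δ : ℝ) : ℝ := 7 / (2 * δ ^ 2)

lemma rate_pos {δ : ℝ} (hδ : 0 < δ) : 0 < rate δ := by unfold rate; positivity

lemma sigmaC_pos {δ : ℝ} (hδ : 0 < δ) : 0 < sigmaC δ := by unfold sigmaC; positivity

lemma sigmaC_sq (δ : ℝ) : sigmaC δ ^ 2 = δ ^ 2 / 7 := by
  rw [sigmaC, div_pow, Real.sq_sqrt (by norm_num)]

lemma rate_eq (δ : ℝ) : 1 / (2 * sigmaC δ ^ 2) = rate δ := by
  rw [sigmaC_sq, rate]
  field_simp

lemma two_rate_sigma {δ : ℝ} (hδ : 0 < δ) : 2 * rate δ * sigmaC δ ^ 2 = 1 := by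
  rw [sigmaC_sq, rate]
  field_simp

lemma alphaC_eq (δ : ℝ) (m : Fin 6) : alphaC δ m = rate δ - (m : ℕ) / 2 := by
  rw [alphaC, rate_eq]
  ring

lemma alphaC_pos {δ : ℝ} (h : 0 < alphaC δ 5) (m : Fin 6) : 0 < alphaC δ m := by
  rw [alphaC_eq] at h ⊢
  have : ((m : ℕ) : ℝ) ≤ 5 := by exact_mod_cast Nat.le_of_lt_succ m.2
  have h5 : (((5 : Fin 6) : ℕ) : ℝ) = 5 := by norm_num
  rw [h5] at h
  linarith

/-- The constant factor in the density of the entry `L_p`. -/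
def entryConst (δ : ℝ) (p : UT) : ℝ :=
  if p.1.1 = p.1.2 then 2 * rate δ ^ alphaC δ p.1.1 / Real.Gamma (alphaC δ p.1.1)
  else (Real.sqrt (2 * Real.pi * sigmaC δ ^ 2))⁻¹

lemma entryConst_pos {δ : ℝ} (hδ : 0 < δ) (hα : 0 < alphaC δ 5) (p : UT) :
    0 < entryConst δ p := by
  have := rate_pos hδ
  have := sigmaC_pos hδ
  have := Real.Gamma_pos_of_pos (alphaC_pos hα p.1.1)
  unfold entryConst
  split_ifs <;> positivity

/-- The density of the entry `L_p`. -/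
def entryPDF (δ : ℝ) (p : UT) (x : ℝ) : ℝ :=
  if p.1.1 = p.1.2 then
    if 0 < x then
      entryConst δ p * (x ^ (2 * alphaC δ p.1.1 - 1) * Real.exp (-(rate δ * x ^ 2))) else 0
  else entryConst δ p * Real.exp (-(rate δ * x ^ 2))

lemma measurable_entryPDF (δ : ℝ) (p : UT) : Measurable (entryPDF δ p) := by
  unfold entryPDF
  split_ifs
  · exact Measurable.ite measurableSet_Ioi (by fun_prop) measurable_const
  · fun_prop

lemma entryPDF_nonneg {δ : ℝ} (hδ : 0 < δ) (hα : 0 < alphaC δ 5) (p : UT) (x : ℝ) :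
    0 ≤ entryPDF δ p x := by
  have := entryConst_pos hδ hα p
  unfold entryPDF
  split_ifs <;> positivity

/-- The entry `L_p` of the triangular factor as a function of the standard normal `G_p`. -/
def entryMap (δ : ℝ) (p : UT) (g : ℝ) : ℝ :=
  if p.1.1 = p.1.2 then sigmaC δ * Real.sqrt (2 * hFun (alphaC δ p.1.1) g) else sigmaC δ * g

/-- The law of the entry `L_p`. -/
def entryLaw (δ : ℝ) (p : UT) : Measure ℝ :=
  volume.withDensity fun x => ENNReal.ofReal (entryPDF δ p x)

lemma measurable_entryMap {δ : ℝ} (hα : 0 < alphaC δ 5) (p : UT) :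
    Measurable (entryMap δ p) := by
  unfold entryMap
  split_ifs
  · have := measurable_hFun (alphaC_pos hα p.1.1)
    fun_prop
  · fun_prop

/-- On the positive half-line the map is inverse to `x ↦ x² / (2σ²)`, with which the change of
variables is made. The Gamma law does not charge the complement. -/
lemma map_sqrt_gammaMeasure {σ : ℝ} (hσ : 0 < σ) (α : ℝ) :
    (gammaMeasure α 1).map (fun y => σ * Real.sqrt (2 * y)) =
      volume.withDensity fun x => ENNReal.ofReal (if 0 < x then
        2 * (1 / (2 * σ ^ 2)) ^ α / Real.Gamma α *
          (x ^ (2 * α - 1) * Real.exp (-(1 / (2 * σ ^ 2) * x ^ 2))) else 0) := by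
  set a := 1 / (2 * σ ^ 2) with ha
  have ha0 : 0 < a := by positivity
  ext s hs
  have hmeas : Measurable fun y => σ * Real.sqrt (2 * y) := by fun_prop
  rw [Measure.map_apply hmeas hs, withDensity_apply _ hs, gammaMeasure,
    withDensity_apply _ (hmeas hs)]
  have himg : (fun x => a * x ^ 2) '' (s ∩ Set.Ioi 0) =
      (fun y => σ * Real.sqrt (2 * y)) ⁻¹' s ∩ Set.Ioi 0 := by
    ext y
    constructor
    · rintro ⟨x, ⟨hxs, hx⟩, rfl⟩
      have hx : 0 < x := hx
      have h1 : σ * Real.sqrt (2 * (a * x ^ 2)) = x := by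
        have : 2 * (a * x ^ 2) = (x / σ) ^ 2 := by rw [ha]; field_simp
        rw [this, Real.sqrt_sq (by positivity)]
        field_simp
      refine ⟨?_, show 0 < a * x ^ 2 by positivity⟩
      rw [Set.mem_preimage, h1]
      exact hxs
    · rintro ⟨hys, hy⟩
      have hy : 0 < y := hy
      refine ⟨σ * Real.sqrt (2 * y), ⟨hys, show 0 < σ * Real.sqrt (2 * y) by positivity⟩, ?_⟩
      simp only [mul_pow]
      rw [Real.sq_sqrt (by positivity), ha]
      field_simp
  have hl : ∫⁻ y in (fun y => σ * Real.sqrt (2 * y)) ⁻¹' s, gammaPDF α 1 y =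
      ∫⁻ y in (fun y => σ * Real.sqrt (2 * y)) ⁻¹' s ∩ Set.Ioi 0, gammaPDF α 1 y := by
    have h0 : gammaMeasure α 1 (Set.Ioi 0)ᶜ = 0 := by
      rw [Set.compl_Ioi]
      exact gammaMeasure_Iic_zero α
    rw [← withDensity_apply _ (hmeas hs), ← withDensity_apply _ ((hmeas hs).inter measurableSet_Ioi)]
    exact (measure_inter_conull h0).symm
  have hr : ∀ f : ℝ → ℝ, ∫⁻ x in s, ENNReal.ofReal (if 0 < x then f x else 0) =
      ∫⁻ x in s ∩ Set.Ioi 0, ENNReal.ofReal (f x) := by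
    intro f
    rw [Set.inter_comm, ← setLIntegral_indicator measurableSet_Ioi]
    refine lintegral_congr fun x => ?_
    by_cases hx : 0 < x <;> simp [hx]
  rw [hl, hr, ← himg, lintegral_image_eq_lintegral_abs_deriv_mul (hs.inter measurableSet_Ioi)
    (f' := fun x => a * (2 * x))]
  · refine setLIntegral_congr_fun (hs.inter measurableSet_Ioi) fun x hx => ?_
    have hx : 0 < x := hx.2
    rw [gammaPDF_of_nonneg (by positivity), ← ENNReal.ofReal_mul (abs_nonneg _),
      abs_of_pos (by positivity)]
    congr 1
    have h1 : (x ^ 2 : ℝ) ^ (α - 1) * x = x ^ (2 * α - 1) := by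
      rw [← Real.rpow_natCast, ← Real.rpow_mul hx.le]
      nth_rewrite 2 [← Real.rpow_one x]
      rw [← Real.rpow_add hx]
      congr 1
      push_cast
      ring
    have h2 : a ^ (α - 1) * a = a ^ α := by
      nth_rewrite 2 [← Real.rpow_one a]
      rw [← Real.rpow_add ha0]
      congr 1
      ring
    rw [← h1, ← h2, Real.mul_rpow ha0.le (by positivity), Real.one_rpow]
    ring_nf
  · intro x _
    have := ((hasDerivAt_pow 2 x).const_mul a).hasDerivWithinAt (s := s ∩ Set.Ioi 0)
    simpa using this
  · intro x hx y hy hxy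
    have hx : 0 < x := hx.2
    have hy : 0 < y := hy.2
    simp only at hxy
    exact (pow_left_inj₀ hx.le hy.le two_ne_zero).1 (mul_left_cancel₀ ha0.ne' hxy)

lemma map_entryMap {δ : ℝ} (hδ : 0 < δ) (hα : 0 < alphaC δ 5) (p : UT) :
    (gaussianReal 0 1).map (entryMap δ p) = entryLaw δ p := by
  by_cases hp : p.1.1 = p.1.2
  · have hα' := alphaC_pos hα p.1.1
    have h1 : entryMap δ p = (fun y => sigmaC δ * Real.sqrt (2 * y)) ∘ hFun (alphaC δ p.1.1) := by
      ext g
      simp [entryMap, hp]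
    rw [h1, ← Measure.map_map (by fun_prop) (measurable_hFun hα'), (hasLaw_hFun hα').map_eq,
      map_sqrt_gammaMeasure (sigmaC_pos hδ), rate_eq]
    simp only [entryLaw, entryPDF, entryConst, hp, if_true]
  · have h1 : entryMap δ p = (sigmaC δ * ·) := by
      ext g
      simp [entryMap, hp]
    have hσ := sigmaC_pos hδ
    rw [h1, gaussianReal_map_const_mul, gaussianReal_of_var_ne_zero]
    · simp only [entryLaw, entryPDF, entryConst, hp, if_false]
      congr 1
      ext x
      simp only [gaussianPDF, gaussianPDFReal, ← rate_eq]
      congr 3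
      · simp
      · simp
        field_simp
    · have : sigmaC δ ^ 2 ≠ 0 := by positivity
      simpa [← NNReal.coe_ne_zero] using this

/-! ### The joint law of the triangular factor -/

/-- A product measure is determined by boxes, where the integral of the product density factorizes.
-/
lemma pi_withDensity_ofReal {ι : Type*} [Fintype ι] (f : ι → ℝ → ℝ)
    (hf0 : ∀ i x, 0 ≤ f i x) (hfi : ∀ i, Integrable (f i)) :
    Measure.pi (fun i => volume.withDensity fun x => ENNReal.ofReal (f i x)) =
      volume.withDensity fun x : ι → ℝ => ENNReal.ofReal (∏ i, f i (x i)) := by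
  have : ∀ i, IsFiniteMeasure (volume.withDensity fun x => ENNReal.ofReal (f i x)) :=
    fun i => isFiniteMeasure_withDensity_ofReal (hfi i).2
  refine Measure.pi_eq fun s hs => ?_
  rw [withDensity_apply _ (MeasurableSet.univ_pi hs), volume_pi, Measure.restrict_pi_pi,
    ← ofReal_integral_eq_lintegral_ofReal, integral_fintype_prod_eq_prod,
    ENNReal.ofReal_prod_of_nonneg]
  · refine Finset.prod_congr rfl fun i _ => ?_
    rw [withDensity_apply _ (hs i), ofReal_integral_eq_lintegral_ofReal]
    · exact (hfi i).integrableOn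
    · exact ae_of_all _ (hf0 i)
  · exact fun i _ => integral_nonneg (hf0 i)
  · exact Integrable.fintype_prod fun i => (hfi i).integrableOn
  · exact ae_of_all _ fun x => Finset.prod_nonneg fun i _ => hf0 i _

/-- The entries of the triangular factor as functions of the standard normal variables. -/
def factorMap (δ : ℝ) (g : UT → ℝ) : UT → ℝ := fun p => entryMap δ p (g p)

lemma upperFactor_eq (δ : ℝ) (g : UT → ℝ) : upperFactor δ g = upperMat (factorMap δ g) := by
  ext m n
  simp only [upperFactor, upperMat, factorMap, entryMap, Matrix.of_apply]
  rcases lt_trichotomy m n with h | h | h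
  · simp [h, h.le, h.ne]
  · subst h
    simp
  · simp [h.not_gt, h.ne', h.not_ge]

lemma measurable_factorMap {δ : ℝ} (hα : 0 < alphaC δ 5) : Measurable (factorMap δ) :=
  measurable_pi_lambda _ fun p => (measurable_entryMap hα p).comp (measurable_pi_apply p)

lemma isProbabilityMeasure_entryLaw {δ : ℝ} (hδ : 0 < δ) (hα : 0 < alphaC δ 5) (p : UT) :
    IsProbabilityMeasure (entryLaw δ p) := by
  rw [← map_entryMap hδ hα]
  exact Measure.isProbabilityMeasure_map (measurable_entryMap hα p).aemeasurable

lemma integrable_entryPDF {δ : ℝ} (hδ : 0 < δ) (hα : 0 < alphaC δ 5) (p : UT) :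
    Integrable (entryPDF δ p) := by
  have := isProbabilityMeasure_entryLaw hδ hα p
  refine ⟨(measurable_entryPDF δ p).aestronglyMeasurable, ?_⟩
  rw [hasFiniteIntegral_iff_ofReal (ae_of_all _ (entryPDF_nonneg hδ hα p))]
  have h := measure_univ (μ := entryLaw δ p)
  rw [entryLaw, withDensity_apply _ MeasurableSet.univ, Measure.restrict_univ] at h
  simp [h]

/-- The law of `21` independent standard normal variables. -/
def stdNormal : Measure (UT → ℝ) := Measure.pi fun _ => gaussianReal 0 1

instance : IsProbabilityMeasure stdNormal := by unfold stdNormal; infer_instance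

/-- The joint law of the entries of the triangular factor. -/
def factorLaw (δ : ℝ) : Measure (UT → ℝ) := Measure.pi (entryLaw δ)

lemma map_factorMap {δ : ℝ} (hδ : 0 < δ) (hα : 0 < alphaC δ 5) :
    stdNormal.map (factorMap δ) = factorLaw δ := by
  have h := fun p => map_entryMap hδ hα p
  have := fun p => isProbabilityMeasure_entryLaw hδ hα p
  have h1 : ∀ p : UT, SigmaFinite ((gaussianReal 0 1).map (entryMap δ p)) := by
    intro p
    rw [h p]
    infer_instance
  unfold stdNormal factorMap factorLaw
  rw [Measure.pi_map_pi fun p => (measurable_entryMap hα p).aemeasurable]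
  simp_rw [h]

lemma isProbabilityMeasure_factorLaw {δ : ℝ} (hδ : 0 < δ) (hα : 0 < alphaC δ 5) :
    IsProbabilityMeasure (factorLaw δ) := by
  rw [← map_factorMap hδ hα]
  exact Measure.isProbabilityMeasure_map (measurable_factorMap hα).aemeasurable

lemma factorLaw_eq {δ : ℝ} (hδ : 0 < δ) (hα : 0 < alphaC δ 5) :
    factorLaw δ = volume.withDensity fun l => ENNReal.ofReal (∏ p, entryPDF δ p (l p)) :=
  pi_withDensity_ofReal _ (entryPDF_nonneg hδ hα) (integrable_entryPDF hδ hα)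

/-! ### The law of the random matrix -/

lemma measurable_gram : Measurable fun l : UT → ℝ => (upperMat l).transpose * upperMat l := by
  simp_rw [← symOf_gramUpper]
  exact measurable_symOf.comp measurable_gramUpper

/-- The product `∏_p c_p / 2⁶` of the constants of the densities of the entries. -/
def jointConst (δ : ℝ) : ℝ := (∏ p, entryConst δ p) / 2 ^ 6

lemma jointConst_pos {δ : ℝ} (hδ : 0 < δ) (hα : 0 < alphaC δ 5) : 0 < jointConst δ :=
  div_pos (Finset.prod_pos fun p _ => entryConst_pos hδ hα p) (by norm_num)

/-- The exponent of the determinant is `rate δ - 7/2`, and the determinant is a product of squares,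
hence the exponent `2 * rate δ - 7`. -/
lemma unnormalizedPdf_gram (δ : ℝ) {l : UT → ℝ} (hδ : 0 < δ) (hl : l ∈ cholCone) :
    unnormalizedPdf δ ((upperMat l).transpose * upperMat l) =
      (∏ m, l (diagIdx m) ^ (2 * rate δ - 7)) * Real.exp (-(rate δ * ∑ p, l p ^ 2)) := by
  rw [unnormalizedPdf, Set.indicator_of_mem (by exact posDef_gram hl), det_gram, trace_gram]
  congr 1
  · rw [← Real.finsetProd_rpow _ _ fun m _ => by positivity]
    refine Finset.prod_congr rfl fun m _ => ?_
    rw [← Real.rpow_natCast, ← Real.rpow_mul (hl m).le]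
    congr 1
    rw [rate]
    push_cast
    field_simp
  · rw [rate]
    ring_nf

/-- The pointwise Bartlett identity. Row `m` has `6 - m` entries, so the Jacobian contributes that
power of the `m`-th diagonal entry, and `(6 - m) + (2 * rate δ - 7) = 2 * alphaC δ m - 1`: this
dictates the shapes `alphaC`. The `2⁶` in `jointConst` absorbs the factors 2 of the Jacobian. -/
lemma prod_entryPDF {δ : ℝ} (hδ : 0 < δ) {l : UT → ℝ} (hl : l ∈ cholCone) :
    ∏ p, entryPDF δ p (l p) = |(gramDeriv l).det| * (jointConst δ *
      unnormalizedPdf δ ((upperMat l).transpose * upperMat l)) := by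
  have h1 : ∀ p, entryPDF δ p (l p) = entryConst δ p *
      ((if p.1.1 = p.1.2 then l (diagIdx p.1.1) ^ (2 * alphaC δ p.1.1 - 1) else 1) *
        Real.exp (-(rate δ * l p ^ 2))) := by
    intro p
    by_cases hp : p.1.1 = p.1.2
    · have : p = diagIdx p.1.1 := Subtype.ext (Prod.ext rfl hp.symm)
      have hpos : 0 < l p := by
        rw [this]
        exact hl _
      simp [entryPDF, hp, hpos]
      rw [← hp, ← this]
      exact Or.inl rfl
    · simp [entryPDF, hp]
  simp_rw [h1]
  rw [Finset.prod_mul_distrib, Finset.prod_mul_distrib, ← Real.exp_sum, unnormalizedPdf_gram δ hδ hl,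
    det_gramDeriv, Finset.prod_mul_distrib, prod_UT_fst fun m => l (diagIdx m),
    prod_UT_diag fun m => l (diagIdx m) ^ (2 * alphaC δ m - 1), prod_UT_diag fun _ => (2 : ℝ),
    Finset.sum_neg_distrib, ← Finset.mul_sum, jointConst]
  have h2 : ∏ m, l (diagIdx m) ^ (2 * alphaC δ m - 1) =
      (∏ m, l (diagIdx m) ^ (6 - (m : ℕ))) * ∏ m, l (diagIdx m) ^ (2 * rate δ - 7) := by
    rw [← Finset.prod_mul_distrib]
    refine Finset.prod_congr rfl fun m _ => ?_
    rw [← Real.rpow_natCast, ← Real.rpow_add (hl m), Nat.cast_sub m.2.le, alphaC_eq]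
    congr 1
    push_cast
    ring
  have h3 : 0 < ∏ m, l (diagIdx m) ^ (6 - (m : ℕ)) :=
    Finset.prod_pos fun m _ => pow_pos (hl m) _
  rw [h2, abs_of_pos (mul_pos h3 (by simp))]
  simp
  ring

/-- Change of variables along `gramUpper`. Both densities vanish off the cone and off its image, so
the integrals may be restricted to where the map is injective. The division by `2 ^ (15 / 2)` undoes
the scaling of the volume element. -/
lemma map_gram_factorLaw_eq_smul {δ : ℝ} (hδ : 0 < δ) (hα : 0 < alphaC δ 5) :
    (factorLaw δ).map (fun l => (upperMat l).transpose * upperMat l) =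
      ENNReal.ofReal (jointConst δ / 2 ^ (15 / 2 : ℝ)) •
        symVolume.withDensity fun C => ENNReal.ofReal (unnormalizedPdf δ C) := by
  have hT : (fun l => (upperMat l).transpose * upperMat l) = symOf ∘ gramUpper := by
    ext l
    simp [symOf_gramUpper]
  have hTm : Measurable (symOf ∘ gramUpper) := measurable_symOf.comp measurable_gramUpper
  ext s hs
  rw [hT, Measure.map_apply hTm hs, Measure.smul_apply, withDensity_apply _ hs, symVolume,
    Measure.restrict_smul, lintegral_smul_measure, measurableEmbedding_symOf.restrict_map,
    measurableEmbedding_symOf.lintegral_map, factorLaw_eq hδ hα, withDensity_apply _ (hTm hs)]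
  have hr : ∫⁻ c in symOf ⁻¹' s, ENNReal.ofReal (unnormalizedPdf δ (symOf c)) =
      ∫⁻ c in gramUpper '' (cholCone ∩ (symOf ∘ gramUpper) ⁻¹' s),
        ENNReal.ofReal (unnormalizedPdf δ (symOf c)) := by
    rw [Set.preimage_comp, Set.image_inter_preimage, image_gramUpper,
      ← setLIntegral_indicator (measurable_symOf measurableSet_posDef)]
    refine lintegral_congr fun c => ?_
    by_cases hc : (symOf c).PosDef
    · rw [Set.indicator_of_mem (by exact hc)]
    · rw [Set.indicator_of_notMem (by exact hc), unnormalizedPdf,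
        Set.indicator_of_notMem (by exact hc), ENNReal.ofReal_zero]
  have hl : ∫⁻ l in symOf ∘ gramUpper ⁻¹' s, ENNReal.ofReal (∏ p, entryPDF δ p (l p)) =
      ∫⁻ l in cholCone ∩ (symOf ∘ gramUpper) ⁻¹' s, ENNReal.ofReal (∏ p, entryPDF δ p (l p)) := by
    rw [← setLIntegral_indicator measurableSet_cholCone]
    refine lintegral_congr fun l => ?_
    by_cases hl : l ∈ cholCone
    · rw [Set.indicator_of_mem hl]
    · rw [Set.indicator_of_notMem hl]
      simp only [cholCone, Set.mem_ofPred_eq, not_forall] at hl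
      obtain ⟨m, hm⟩ := hl
      rw [Finset.prod_eq_zero (Finset.mem_univ (diagIdx m)), ENNReal.ofReal_zero]
      rw [entryPDF, if_pos (by rfl), if_neg hm]
  have hS := measurableSet_cholCone.inter (hTm hs)
  rw [hl, hr, lintegral_image_eq_lintegral_abs_det_fderiv_mul _ hS
    (fun l _ => (hasFDerivAt_gramUpper l).hasFDerivWithinAt)
    (injOn_gramUpper.mono Set.inter_subset_left), smul_eq_mul, smul_eq_mul, ← mul_assoc,
    ← ENNReal.ofReal_mul (div_nonneg (jointConst_pos hδ hα).le (by positivity)),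
    div_mul_cancel₀ _ (by positivity), ← lintegral_const_mul' _ _ ENNReal.ofReal_ne_top]
  refine setLIntegral_congr_fun hS fun l hl => ?_
  rw [prod_entryPDF hδ hl.1, symOf_gramUpper, ENNReal.ofReal_mul (abs_nonneg _),
    ENNReal.ofReal_mul (jointConst_pos hδ hα).le]
  ring

lemma measurable_det : Measurable fun C : M6 => C.det := by
  simp_rw [Matrix.det_apply]
  exact Finset.measurable_sum _ fun σ _ =>
    (Finset.measurable_prod _ fun i _ => measurable_entry (σ i) i).const_smul (Equiv.Perm.sign σ)

lemma measurable_trace : Measurable fun C : M6 => C.trace :=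
  Finset.measurable_sum _ fun i _ => measurable_entry i i

lemma measurable_unnormalizedPdf (δ : ℝ) : Measurable (unnormalizedPdf δ) := by
  refine Measurable.indicator ?_ measurableSet_posDef
  have := measurable_det
  have := measurable_trace
  fun_prop

lemma unnormalizedPdf_nonneg (δ : ℝ) (C : M6) : 0 ≤ unnormalizedPdf δ C := by
  refine Set.indicator_nonneg (fun C hC => ?_) C
  have : 0 < C.det := hC.det_pos
  positivity

/-- The left side of `map_gram_factorLaw_eq_smul` has total mass 1, which evaluates the normalizing
integral. -/
lemma normConst_eq {δ : ℝ} (hδ : 0 < δ) (hα : 0 < alphaC δ 5) :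
    normConst δ = jointConst δ / 2 ^ (15 / 2 : ℝ) := by
  have hK : 0 < jointConst δ / 2 ^ (15 / 2 : ℝ) := div_pos (jointConst_pos hδ hα) (by positivity)
  set K := jointConst δ / 2 ^ (15 / 2 : ℝ) with hKdef
  have := isProbabilityMeasure_factorLaw hδ hα
  have h := congrArg (fun μ => μ Set.univ) (map_gram_factorLaw_eq_smul hδ hα)
  simp only [Measure.map_apply measurable_gram MeasurableSet.univ, Set.preimage_univ, measure_univ,
    Measure.smul_apply, withDensity_apply _ MeasurableSet.univ, Measure.restrict_univ,
    smul_eq_mul] at h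
  rw [normConst, integral_eq_lintegral_of_nonneg_ae (ae_of_all _ (unnormalizedPdf_nonneg δ))
    (measurable_unnormalizedPdf δ).aestronglyMeasurable, ← ENNReal.toReal_inv]
  rw [← ENNReal.eq_inv_of_mul_eq_one_left h.symm, ENNReal.toReal_ofReal hK.le]

lemma normConst_pos {δ : ℝ} (hδ : 0 < δ) (hα : 0 < alphaC δ 5) : 0 < normConst δ := by
  rw [normConst_eq hδ hα]
  exact div_pos (jointConst_pos hδ hα) (by positivity)

/-- The Bartlett decomposition: the law `p(C) d^S C` is that of `Lᵀ L`. -/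
lemma map_gram_factorLaw {δ : ℝ} (hδ : 0 < δ) (hα : 0 < alphaC δ 5) :
    (factorLaw δ).map (fun l => (upperMat l).transpose * upperMat l) = densityLaw (pdfC δ) := by
  rw [map_gram_factorLaw_eq_smul hδ hα, ← normConst_eq hδ hα, densityLaw,
    ← withDensity_smul' _ _ ENNReal.ofReal_ne_top]
  congr 1
  ext C
  rw [Pi.smul_apply, smul_eq_mul, ← ENNReal.ofReal_mul (normConst_pos hδ hα).le, pdfC]

lemma isProbabilityMeasure_densityLaw_pdfC {δ : ℝ} (hδ : 0 < δ) (hα : 0 < alphaC δ 5) :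
    IsProbabilityMeasure (densityLaw (pdfC δ)) := by
  have := isProbabilityMeasure_factorLaw hδ hα
  rw [← map_gram_factorLaw hδ hα]
  exact Measure.isProbabilityMeasure_map measurable_gram.aemeasurable

/-! ### Moments of the Gamma and normal laws -/

lemma ae_pos_gammaMeasure (α : ℝ) : ∀ᵐ y ∂gammaMeasure α 1, 0 < y := by
  rw [ae_iff]
  simp only [not_lt]
  exact gammaMeasure_Iic_zero α

/-- Multiplying the density of shape `α` by `y ^ s` gives, up to the Gamma ratio, the density of
shape `α + s`. Negative `s` is allowed and is used for logarithms and inverse moments. -/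
lemma lintegral_rpow_gammaMeasure {α s : ℝ} (hα : 0 < α) (hs : 0 < α + s) :
    ∫⁻ y, ENNReal.ofReal (y ^ s) ∂gammaMeasure α 1 =
      ENNReal.ofReal (Real.Gamma (α + s) / Real.Gamma α) := by
  have h1 := Real.Gamma_pos_of_pos hα
  have h2 := Real.Gamma_pos_of_pos hs
  rw [gammaMeasure, lintegral_withDensity_eq_lintegral_mul _ (by unfold gammaPDF; fun_prop)
    (by fun_prop)]
  rw [← mul_one (ENNReal.ofReal (Real.Gamma (α + s) / Real.Gamma α)),
    ← lintegral_gammaPDF_eq_one hs one_pos, ← lintegral_const_mul' _ _ ENNReal.ofReal_ne_top]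
  refine lintegral_congr_ae ?_
  filter_upwards [Measure.ae_ne volume (0 : ℝ)] with y hy
  rcases hy.lt_or_gt with hy | hy
  · simp [gammaPDF_of_neg hy]
  · simp only [Pi.mul_apply]
    rw [gammaPDF_of_nonneg hy.le, gammaPDF_of_nonneg hy.le, ← ENNReal.ofReal_mul (by positivity),
      ← ENNReal.ofReal_mul (by positivity)]
    congr 1
    rw [show α + s - 1 = (α - 1) + s by ring, Real.rpow_add hy]
    simp only [Real.one_rpow]
    field_simp

lemma integrable_rpow_gammaMeasure {α s : ℝ} (hα : 0 < α) (hs : 0 < α + s) :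
    Integrable (fun y => y ^ s) (gammaMeasure α 1) := by
  refine ⟨by fun_prop, ?_⟩
  rw [hasFiniteIntegral_iff_ofReal, lintegral_rpow_gammaMeasure hα hs]
  · exact ENNReal.ofReal_lt_top
  · filter_upwards [ae_pos_gammaMeasure α] with y hy
    exact Real.rpow_nonneg hy.le _

lemma integral_rpow_gammaMeasure {α s : ℝ} (hα : 0 < α) (hs : 0 < α + s) :
    ∫ y, y ^ s ∂gammaMeasure α 1 = Real.Gamma (α + s) / Real.Gamma α := by
  have h1 := Real.Gamma_pos_of_pos hα
  have h2 := Real.Gamma_pos_of_pos hs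
  rw [integral_eq_lintegral_of_nonneg_ae, lintegral_rpow_gammaMeasure hα hs,
    ENNReal.toReal_ofReal (by positivity)]
  · filter_upwards [ae_pos_gammaMeasure α] with y hy
    exact Real.rpow_nonneg hy.le _
  · fun_prop

lemma integrable_gammaMeasure_id {α : ℝ} (hα : 0 < α) :
    Integrable (fun y => y) (gammaMeasure α 1) := by
  simpa using integrable_rpow_gammaMeasure hα (s := 1) (by linarith)

lemma integral_gammaMeasure_id {α : ℝ} (hα : 0 < α) : ∫ y, y ∂gammaMeasure α 1 = α := by
  have h := integral_rpow_gammaMeasure hα (s := 1) (by linarith)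
  simp only [Real.rpow_one] at h
  rw [h, Real.Gamma_add_one hα.ne', mul_div_cancel_right₀ _ (Real.Gamma_pos_of_pos hα).ne']

lemma integrable_gammaMeasure_sq {α : ℝ} (hα : 0 < α) :
    Integrable (fun y => y ^ 2) (gammaMeasure α 1) := by
  simpa using integrable_rpow_gammaMeasure hα (s := 2) (by linarith)

lemma integral_gammaMeasure_sq {α : ℝ} (hα : 0 < α) :
    ∫ y, y ^ 2 ∂gammaMeasure α 1 = α * (α + 1) := by
  have h := integral_rpow_gammaMeasure hα (s := 2) (by linarith)
  simp only [Real.rpow_two] at h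
  rw [h, show α + 2 = (α + 1) + 1 by ring, Real.Gamma_add_one (by linarith),
    Real.Gamma_add_one hα.ne']
  have := (Real.Gamma_pos_of_pos hα).ne'
  field_simp

lemma integrable_log_gammaMeasure {α : ℝ} (hα : 0 < α) :
    Integrable Real.log (gammaMeasure α 1) := by
  have h1 := integrable_gammaMeasure_id hα
  -- Near 0, `-log y` is dominated by `(2/α) y^(-α/2)`; this exponent still leaves the positive
  -- shape `α/2`.
  have h2 := (integrable_rpow_gammaMeasure hα (s := -(α / 2)) (by linarith)).const_mul (2 / α)
  refine (h1.add h2).mono' Real.measurable_log.aestronglyMeasurable ?_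
  filter_upwards [ae_pos_gammaMeasure α] with y hy
  have h3 : 0 < y ^ (-(α / 2)) := Real.rpow_pos_of_pos hy _
  have h4 := Real.log_le_sub_one_of_pos h3
  rw [Real.log_rpow hy] at h4
  have h5 := Real.log_le_sub_one_of_pos hy
  have h6 : 0 < 2 / α * y ^ (-(α / 2)) := by positivity
  simp only [Pi.add_apply, Real.norm_eq_abs]
  rw [abs_le]
  constructor
  · have : -Real.log y ≤ 2 / α * y ^ (-(α / 2)) := by
      rw [div_mul_eq_mul_div, le_div_iff₀ hα]
      linarith
    linarith
  · linarith

lemma integrable_pow_gaussianReal (k : ℕ) : Integrable (fun x => x ^ k) (gaussianReal 0 1) := by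
  have h : MemLp id (k : ℝ≥0∞) (gaussianReal 0 1) :=
    memLp_id_gaussianReal' _ (ENNReal.natCast_ne_top k)
  have := h.integrable_norm_pow'
  rw [← integrable_norm_iff (by fun_prop)]
  simpa [norm_pow] using this

lemma integral_sq_gaussianReal : ∫ x, x ^ 2 ∂gaussianReal 0 1 = 1 := by
  have h := variance_fun_id_gaussianReal (μ := 0) (v := 1)
  rw [variance_eq_integral (by fun_prop), integral_id_gaussianReal] at h
  simpa using h

lemma integral_pow_four_gaussianReal : ∫ x, x ^ 4 ∂gaussianReal 0 1 = 3 := by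
  rw [integral_gaussianReal_eq_integral_smul one_ne_zero]
  have h1 : ∀ x : ℝ, gaussianPDFReal 0 1 x • x ^ 4 =
      (Real.sqrt (2 * Real.pi))⁻¹ * (|x| ^ (4 : ℝ) * Real.exp (-(1 / 2) * |x| ^ (2 : ℝ))) := by
    intro x
    have h4 : |x| ^ (4 : ℝ) = x ^ 4 := by
      rw [show (4 : ℝ) = ((4 : ℕ) : ℝ) by norm_num, Real.rpow_natCast]
      exact Even.pow_abs (by decide) x
    have h2 : |x| ^ (2 : ℝ) = x ^ 2 := by
      rw [Real.rpow_two, sq_abs]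
    rw [h4, h2, gaussianPDFReal]
    simp only [NNReal.coe_one, smul_eq_mul, mul_one, sub_zero]
    ring_nf
  simp_rw [h1]
  rw [integral_const_mul,
    integral_comp_abs (f := fun x => x ^ (4 : ℝ) * Real.exp (-(1 / 2) * x ^ (2 : ℝ))),
    integral_rpow_mul_exp_neg_mul_rpow (by norm_num) (by norm_num) (by norm_num),
    show ((4 : ℝ) + 1) / 2 = (1 / 2 + 1) + 1 by norm_num, Real.Gamma_add_one (by norm_num),
    Real.Gamma_add_one (by norm_num), Real.Gamma_one_half_eq,
    Real.sqrt_mul (by norm_num)]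
  have h5 : (1 / 2 : ℝ) ^ (-(4 + 1) / 2 : ℝ) = 4 * Real.sqrt 2 := by
    rw [show (-(4 + 1) / 2 : ℝ) = -(2 + 1 / 2) by norm_num, Real.rpow_neg (by norm_num),
      Real.rpow_add (by norm_num), ← Real.sqrt_eq_rpow, Real.rpow_two, one_div, Real.sqrt_inv]
    norm_num
    ring
  rw [h5]
  have h6 : Real.sqrt 2 ≠ 0 := by positivity
  have h7 : Real.sqrt Real.pi ≠ 0 := by positivity
  field_simp
  norm_num

/-! ### Moments of the entries of the triangular factor -/

lemma measurable_sqrtScale (σ : ℝ) : Measurable fun y => σ * Real.sqrt (2 * y) := by fun_prop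

lemma entryLaw_diag {δ : ℝ} (hδ : 0 < δ) (m : Fin 6) :
    entryLaw δ (diagIdx m) =
      (gammaMeasure (alphaC δ m) 1).map fun y => sigmaC δ * Real.sqrt (2 * y) := by
  rw [map_sqrt_gammaMeasure (sigmaC_pos hδ), rate_eq]
  simp [entryLaw, entryPDF, entryConst, diagIdx]

lemma entryLaw_offDiag {δ : ℝ} (hδ : 0 < δ) (hα : 0 < alphaC δ 5) {p : UT}
    (hp : p.1.1 ≠ p.1.2) : entryLaw δ p = (gaussianReal 0 1).map (sigmaC δ * ·) := by
  rw [← map_entryMap hδ hα]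
  congr 1
  ext g
  simp [entryMap, hp]

lemma eq_diagIdx {p : UT} (hp : p.1.1 = p.1.2) : p = diagIdx p.1.1 :=
  Subtype.ext (Prod.ext rfl hp.symm)

/-- `E [L_p²] / σ²`. -/
def entryScale (δ : ℝ) (p : UT) : ℝ := if p.1.1 = p.1.2 then 2 * alphaC δ p.1.1 else 1

lemma sq_sqrtScale (σ : ℝ) {y : ℝ} (hy : 0 < y) :
    (σ * Real.sqrt (2 * y)) ^ 2 = 2 * σ ^ 2 * y := by
  rw [mul_pow, Real.sq_sqrt (by positivity)]
  ring

lemma integrable_entry_pow_four {δ : ℝ} (hδ : 0 < δ) (hα : 0 < alphaC δ 5) (p : UT) :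
    Integrable (fun x => x ^ 4) (entryLaw δ p) := by
  by_cases hp : p.1.1 = p.1.2
  · rw [eq_diagIdx hp, entryLaw_diag hδ, integrable_map_measure (by fun_prop)
      (measurable_sqrtScale _).aemeasurable]
    refine ((integrable_gammaMeasure_sq (alphaC_pos hα p.1.1)).const_mul
      ((2 * sigmaC δ ^ 2) ^ 2)).congr ?_
    filter_upwards [ae_pos_gammaMeasure (alphaC δ p.1.1)] with y hy
    simp only [Function.comp_apply]
    rw [show 4 = 2 * 2 by norm_num, pow_mul, sq_sqrtScale _ hy]
    ring
  · rw [entryLaw_offDiag hδ hα hp, integrable_map_measure (by fun_prop) (by fun_prop)]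
    simpa [Function.comp_def, mul_pow] using (integrable_pow_gaussianReal 4).const_mul _

/-- With `s = entryScale δ p`, one formula covers both kinds of entry: `s = 1` gives the normal
fourth moment 3, and `s = 2α` gives `4α(α + 1)`. Both squared entries are `σ²` times a chi-square
variable with `s` degrees of freedom. -/
lemma integral_entry_pow_four {δ : ℝ} (hδ : 0 < δ) (hα : 0 < alphaC δ 5) (p : UT) :
    ∫ x, x ^ 4 ∂entryLaw δ p =
      sigmaC δ ^ 4 * (2 * entryScale δ p + entryScale δ p ^ 2) := by
  by_cases hp : p.1.1 = p.1.2
  · rw [eq_diagIdx hp, entryLaw_diag hδ, integral_map (measurable_sqrtScale _).aemeasurable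
      (by fun_prop)]
    have h : (fun y => (sigmaC δ * Real.sqrt (2 * y)) ^ 4) =ᵐ[gammaMeasure (alphaC δ p.1.1) 1]
        fun y => (2 * sigmaC δ ^ 2) ^ 2 * y ^ 2 := by
      filter_upwards [ae_pos_gammaMeasure (alphaC δ p.1.1)] with y hy
      rw [show 4 = 2 * 2 by norm_num, pow_mul, sq_sqrtScale _ hy, mul_pow]
    rw [integral_congr_ae h, integral_const_mul, integral_gammaMeasure_sq (alphaC_pos hα _)]
    simp only [entryScale, diagIdx, if_true]
    ring
  · rw [entryLaw_offDiag hδ hα hp, integral_map (by fun_prop) (by fun_prop)]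
    simp_rw [mul_pow]
    rw [integral_const_mul, integral_pow_four_gaussianReal, entryScale, if_neg hp]
    ring

lemma integral_entry_sq {δ : ℝ} (hδ : 0 < δ) (hα : 0 < alphaC δ 5) (p : UT) :
    ∫ x, x ^ 2 ∂entryLaw δ p = sigmaC δ ^ 2 * entryScale δ p := by
  by_cases hp : p.1.1 = p.1.2
  · rw [eq_diagIdx hp, entryLaw_diag hδ, integral_map (measurable_sqrtScale _).aemeasurable
      (by fun_prop)]
    have h : (fun y => (sigmaC δ * Real.sqrt (2 * y)) ^ 2) =ᵐ[gammaMeasure (alphaC δ p.1.1) 1]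
        fun y => (2 * sigmaC δ ^ 2) * y := by
      filter_upwards [ae_pos_gammaMeasure (alphaC δ p.1.1)] with y hy
      rw [sq_sqrtScale _ hy]
    rw [integral_congr_ae h, integral_const_mul, integral_gammaMeasure_id (alphaC_pos hα _)]
    simp only [entryScale, diagIdx, if_true]
    ring
  · rw [entryLaw_offDiag hδ hα hp, integral_map (by fun_prop) (by fun_prop)]
    simp_rw [mul_pow]
    rw [integral_const_mul, integral_sq_gaussianReal, entryScale, if_neg hp]

lemma integral_entry_offDiag {δ : ℝ} (hδ : 0 < δ) (hα : 0 < alphaC δ 5) {p : UT}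
    (hp : p.1.1 ≠ p.1.2) : ∫ x, x ∂entryLaw δ p = 0 := by
  rw [entryLaw_offDiag hδ hα hp, integral_map (by fun_prop) (by fun_prop), integral_const_mul,
    integral_id_gaussianReal, mul_zero]

lemma ae_pos_entryLaw {δ : ℝ} (hδ : 0 < δ) (m : Fin 6) :
    ∀ᵐ x ∂entryLaw δ (diagIdx m), 0 < x := by
  rw [entryLaw_diag hδ, ae_map_iff (measurable_sqrtScale _).aemeasurable measurableSet_Ioi]
  filter_upwards [ae_pos_gammaMeasure (alphaC δ m)] with y hy
  have := sigmaC_pos hδ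
  positivity

/-- `E log Y` for `Y` of the Gamma law with parameter `α`. -/
def meanLog (α : ℝ) : ℝ := ∫ y, Real.log y ∂gammaMeasure α 1

lemma log_sq_sqrtScale {σ : ℝ} (hσ : 0 < σ) (α : ℝ) :
    (fun y => Real.log ((σ * Real.sqrt (2 * y)) ^ 2)) =ᵐ[gammaMeasure α 1]
      fun y => Real.log (2 * σ ^ 2) + Real.log y := by
  filter_upwards [ae_pos_gammaMeasure α] with y hy
  rw [sq_sqrtScale _ hy, Real.log_mul (by positivity) hy.ne']

lemma integrable_entry_log_sq {δ : ℝ} (hδ : 0 < δ) (hα : 0 < alphaC δ 5) (m : Fin 6) :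
    Integrable (fun x => Real.log (x ^ 2)) (entryLaw δ (diagIdx m)) := by
  have := isProbabilityMeasure_gammaMeasure (alphaC_pos hα m) one_pos
  have hm : Measurable fun x : ℝ => Real.log (x ^ 2) := by fun_prop
  rw [entryLaw_diag hδ, integrable_map_measure hm.aestronglyMeasurable
    (measurable_sqrtScale _).aemeasurable]
  exact ((integrable_const _).add (integrable_log_gammaMeasure (alphaC_pos hα m))).congr
    (log_sq_sqrtScale (sigmaC_pos hδ) _).symm

lemma integral_entry_log_sq {δ : ℝ} (hδ : 0 < δ) (hα : 0 < alphaC δ 5) (m : Fin 6) :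
    ∫ x, Real.log (x ^ 2) ∂entryLaw δ (diagIdx m) =
      meanLog (alphaC δ m) - Real.log (rate δ) := by
  have := isProbabilityMeasure_gammaMeasure (alphaC_pos hα m) one_pos
  have hm : Measurable fun x : ℝ => Real.log (x ^ 2) := by fun_prop
  rw [entryLaw_diag hδ, integral_map (measurable_sqrtScale _).aemeasurable hm.aestronglyMeasurable,
    integral_congr_ae (log_sq_sqrtScale (sigmaC_pos hδ) _),
    integral_add (integrable_const _) (integrable_log_gammaMeasure (alphaC_pos hα m)), meanLog,
    ← rate_eq, one_div, Real.log_inv]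
  simp
  ring

/-- Integrability of the functions bounding the inverse matrix. -/
lemma integrable_entry_inverse {δ : ℝ} (hδ : 0 < δ) (hα : 2 < alphaC δ 5) (k : ℕ) (p : UT) :
    Integrable (fun x => (1 + x ^ 2) ^ k * if p.1.1 = p.1.2 then (x ^ 4)⁻¹ else 1)
      (entryLaw δ p) := by
  have hα0 : 0 < alphaC δ 5 := by linarith
  have hσ := sigmaC_pos hδ
  by_cases hp : p.1.1 = p.1.2
  · simp only [hp, if_true]
    have hm : Measurable fun x : ℝ => (1 + x ^ 2) ^ k * (x ^ 4)⁻¹ := by fun_prop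
    have hαp : 2 < alphaC δ p.1.1 := by
      refine hα.trans_le ?_
      rw [alphaC_eq, alphaC_eq]
      have h1 : ((p.1.1 : ℕ) : ℝ) ≤ 5 := by exact_mod_cast Nat.le_of_lt_succ p.1.1.2
      have h5 : (((5 : Fin 6) : ℕ) : ℝ) = 5 := by norm_num
      rw [h5]
      linarith
    rw [eq_diagIdx hp, entryLaw_diag hδ, integrable_map_measure hm.aestronglyMeasurable
      (measurable_sqrtScale _).aemeasurable]
    set α := alphaC δ p.1.1
    set s := 2 * sigmaC δ ^ 2 with hs
    have hs0 : 0 < s := by positivity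
    -- The inverse fourth power of a diagonal entry is a multiple of `y⁻²`, integrable because the
    -- shape exceeds 2. The factor `2 ^ (k - 1)` comes from convexity, `(1 + t)^k ≤ 2^(k-1) (1 +
    -- t^k)`.
    have h1 := (integrable_rpow_gammaMeasure (α := α) (s := -2) (by linarith)
      (by linarith)).const_mul (2 ^ (k - 1) * (s ^ 2)⁻¹)
    have h2 := (integrable_rpow_gammaMeasure (α := α) (s := (k : ℝ) - 2) (by linarith) (by
      have : (0 : ℝ) ≤ k := Nat.cast_nonneg k
      linarith)).const_mul (2 ^ (k - 1) * (s ^ 2)⁻¹ * s ^ k)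
    refine (h1.add h2).mono' (hm.comp (measurable_sqrtScale _)).aestronglyMeasurable ?_
    filter_upwards [ae_pos_gammaMeasure α] with y hy
    simp only [Function.comp_apply, Pi.add_apply]
    rw [show 4 = 2 * 2 by norm_num, pow_mul, sq_sqrtScale _ hy, ← hs, Real.norm_of_nonneg
      (by positivity)]
    have h3 := add_pow_le zero_le_one (mul_pos hs0 hy).le k
    rw [one_pow, mul_pow] at h3
    have h4 : y ^ (-2 : ℝ) = (y ^ 2)⁻¹ := by
      rw [Real.rpow_neg hy.le, Real.rpow_two]
    have h5 : y ^ ((k : ℝ) - 2) = y ^ k * (y ^ 2)⁻¹ := by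
      rw [sub_eq_add_neg, Real.rpow_add hy, h4, Real.rpow_natCast]
    rw [h4, h5, mul_pow]
    calc (1 + s * y) ^ k * (s ^ 2 * y ^ 2)⁻¹
        ≤ 2 ^ (k - 1) * (1 + s ^ k * y ^ k) * (s ^ 2 * y ^ 2)⁻¹ := by gcongr
      _ = _ := by rw [mul_inv]; ring
  · simp only [hp, if_false, mul_one]
    rw [entryLaw_offDiag hδ hα0 hp, integrable_map_measure (by fun_prop) (by fun_prop)]
    have h1 := ((integrable_pow_gaussianReal (2 * k)).const_mul
      (2 ^ (k - 1) * (sigmaC δ ^ 2) ^ k)).add (integrable_const (2 ^ (k - 1) : ℝ))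
    refine h1.mono' (by fun_prop) (ae_of_all _ fun x => ?_)
    simp only [Function.comp_apply, Pi.add_apply]
    rw [Real.norm_of_nonneg (by positivity)]
    have h3 := add_pow_le zero_le_one (sq_nonneg (sigmaC δ * x)) k
    refine h3.trans_eq ?_
    rw [one_pow, mul_pow, mul_pow, pow_mul x]
    ring

/-! ### Moments of the random matrix -/

section Moments

variable {δ : ℝ}

/-- `E [L_{km}²] / σ²`, for all pairs `(k, m)`. -/
def rowScale (δ : ℝ) (k m : Fin 6) : ℝ := if k < m then 1 else if k = m then 2 * alphaC δ m else 0

lemma rowScale_of_le {k m : Fin 6} (h : k ≤ m) :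
    rowScale δ k m = entryScale δ ⟨(k, m), h⟩ := by
  unfold rowScale entryScale
  rcases h.lt_or_eq with h' | h'
  · simp [h', h'.ne]
  · subst h'
    simp

lemma rowScale_of_gt {k m : Fin 6} (h : m < k) : rowScale δ k m = 0 := by
  simp [rowScale, h.not_gt, h.ne']

/-- The `m` unit terms above the diagonal compensate the loss `m` in `2 * alphaC δ m = 2 * rate δ -
m`, so every column has the same mean square norm. -/
lemma sum_rowScale (m : Fin 6) : ∑ k, rowScale δ k m = 2 * rate δ := by
  have h : ∀ k, rowScale δ k m = (if k < m then 1 else 0) +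
      if k = m then 2 * alphaC δ m else 0 := by
    intro k
    unfold rowScale
    rcases lt_trichotomy k m with h | h | h
    · simp [h, h.ne]
    · simp [h]
    · simp [h.not_gt, h.ne']
  simp_rw [h]
  rw [Finset.sum_add_distrib, Finset.sum_ite_eq' Finset.univ m, alphaC_eq]
  simp only [Finset.mem_univ, if_true, Finset.sum_boole]
  have : ((Finset.univ.filter fun k : Fin 6 => k < m).card : ℝ) = (m : ℕ) := by
    congr 1
    clear h
    revert m
    decide
  rw [this]
  ring

/-- Wherever the first factor is nonzero, `k ≤ m < n`, and the second factor is 1. -/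
lemma sum_rowScale_mul {m n : Fin 6} (hmn : m < n) :
    ∑ k, rowScale δ k m * rowScale δ k n = 2 * rate δ := by
  rw [← sum_rowScale (δ := δ) m]
  refine Finset.sum_congr rfl fun k _ => ?_
  rcases le_or_gt k m with h | h
  · have : rowScale δ k n = 1 := by simp [rowScale, h.trans_lt hmn]
    rw [this, mul_one]
  · rw [rowScale_of_gt h, zero_mul]

lemma iIndepFun_coord (hδ : 0 < δ) (hα : 0 < alphaC δ 5) :
    iIndepFun (fun (p : UT) (l : UT → ℝ) => l p) (factorLaw δ) := by
  have := fun p => isProbabilityMeasure_entryLaw hδ hα p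
  exact iIndepFun_pi (μ := entryLaw δ) (X := fun _ x => x) fun _ => aemeasurable_id

lemma integral_coord (hδ : 0 < δ) (hα : 0 < alphaC δ 5) {f : ℝ → ℝ} (hf : Measurable f) (p : UT) :
    ∫ l, f (l p) ∂factorLaw δ = ∫ x, f x ∂entryLaw δ p := by
  have := fun p => isProbabilityMeasure_entryLaw hδ hα p
  exact integral_comp_eval hf.aestronglyMeasurable

lemma integrable_coord (hδ : 0 < δ) (hα : 0 < alphaC δ 5) {f : ℝ → ℝ} {p : UT}
    (hf : Integrable f (entryLaw δ p)) : Integrable (fun l => f (l p)) (factorLaw δ) := by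
  have := fun p => isProbabilityMeasure_entryLaw hδ hα p
  exact integrable_comp_eval hf

lemma integrable_upperMat_pow_four (hδ : 0 < δ) (hα : 0 < alphaC δ 5) (k m : Fin 6) :
    Integrable (fun l => upperMat l k m ^ 4) (factorLaw δ) := by
  rcases le_or_gt k m with h | h
  · simp_rw [upperMat_of_le _ h]
    exact integrable_coord hδ hα (integrable_entry_pow_four hδ hα _)
  · simp [upperMat_of_lt _ h]

lemma integral_upperMat_pow_four (hδ : 0 < δ) (hα : 0 < alphaC δ 5) (k m : Fin 6) :
    ∫ l, upperMat l k m ^ 4 ∂factorLaw δ =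
      sigmaC δ ^ 4 * (2 * rowScale δ k m + rowScale δ k m ^ 2) := by
  rcases le_or_gt k m with h | h
  · simp_rw [upperMat_of_le _ h]
    rw [integral_coord hδ hα (f := fun x => x ^ 4) (by fun_prop), integral_entry_pow_four hδ hα,
      rowScale_of_le h]
  · simp [upperMat_of_lt _ h, rowScale_of_gt h]

lemma integral_upperMat_sq (hδ : 0 < δ) (hα : 0 < alphaC δ 5) (k m : Fin 6) :
    ∫ l, upperMat l k m ^ 2 ∂factorLaw δ = sigmaC δ ^ 2 * rowScale δ k m := by
  rcases le_or_gt k m with h | h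
  · simp_rw [upperMat_of_le _ h]
    rw [integral_coord hδ hα (f := fun x => x ^ 2) (by fun_prop), integral_entry_sq hδ hα,
      rowScale_of_le h]
  · simp [upperMat_of_lt _ h, rowScale_of_gt h]

lemma integral_upperMat_of_ne (hδ : 0 < δ) (hα : 0 < alphaC δ 5) {k m : Fin 6} (hkm : k ≠ m) :
    ∫ l, upperMat l k m ∂factorLaw δ = 0 := by
  rcases le_or_gt k m with h | h
  · simp_rw [upperMat_of_le _ h]
    rw [integral_coord hδ hα (f := fun x => x) measurable_id, integral_entry_offDiag hδ hα]
    exact hkm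
  · simp [upperMat_of_lt _ h]

lemma indepFun_upperMat (hδ : 0 < δ) (hα : 0 < alphaC δ 5) (k : Fin 6) {m n : Fin 6}
    (hmn : m ≠ n) : IndepFun (fun l => upperMat l k m) (fun l => upperMat l k n) (factorLaw δ) := by
  have := isProbabilityMeasure_factorLaw hδ hα
  rcases le_or_gt k m with h | h
  · rcases le_or_gt k n with h' | h'
    · simp_rw [upperMat_of_le _ h, upperMat_of_le _ h']
      refine (iIndepFun_coord hδ hα).indepFun (i := ⟨(k, m), h⟩) (j := ⟨(k, n), h'⟩) ?_
      simp [hmn]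
    · simp_rw [upperMat_of_lt _ h']
      exact indepFun_const_right _ _
  · simp_rw [upperMat_of_lt _ h]
    exact indepFun_const_left _ _

/-- Distinct rows use disjoint sets of coordinates; a product meeting the zero part of a row is
constant. -/
lemma indepFun_upperMat_mul (hδ : 0 < δ) (hα : 0 < alphaC δ 5) {k k' : Fin 6} (hk : k ≠ k')
    (m n : Fin 6) : IndepFun (fun l => upperMat l k m * upperMat l k n)
      (fun l => upperMat l k' m * upperMat l k' n) (factorLaw δ) := by
  have := isProbabilityMeasure_factorLaw hδ hα
  have key : ∀ k, (∃ (h : k ≤ m) (h' : k ≤ n), ∀ l, upperMat l k m * upperMat l k n =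
      l ⟨(k, m), h⟩ * l ⟨(k, n), h'⟩) ∨ ∀ l, upperMat l k m * upperMat l k n = 0 := by
    intro k
    rcases le_or_gt k m with h | h
    · rcases le_or_gt k n with h' | h'
      · exact Or.inl ⟨h, h', fun l => by rw [upperMat_of_le _ h, upperMat_of_le _ h']⟩
      · exact Or.inr fun l => by rw [upperMat_of_lt _ h', mul_zero]
    · exact Or.inr fun l => by rw [upperMat_of_lt _ h, zero_mul]
  rcases key k with ⟨h1, h2, h⟩ | h
  · rcases key k' with ⟨h1', h2', h'⟩ | h'
    · simp_rw [h, h']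
      exact (iIndepFun_coord hδ hα).indepFun_mul_mul (fun p => measurable_pi_apply p)
        ⟨(k, m), h1⟩ ⟨(k, n), h2⟩ ⟨(k', m), h1'⟩ ⟨(k', n), h2'⟩ (by simp [hk]) (by simp [hk])
        (by simp [hk]) (by simp [hk])
    · simp_rw [h']
      exact indepFun_const_right _ _
  · simp_rw [h]
    exact indepFun_const_left _ _

lemma measurable_upperMat_mul (k m n : Fin 6) :
    Measurable fun l => upperMat l k m * upperMat l k n :=
  (measurable_upperMat k m).mul (measurable_upperMat k n)

lemma memLp_upperMat_mul (hδ : 0 < δ) (hα : 0 < alphaC δ 5) (k m n : Fin 6) :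
    MemLp (fun l => upperMat l k m * upperMat l k n) 2 (factorLaw δ) := by
  rw [memLp_two_iff_integrable_sq (measurable_upperMat_mul k m n).aestronglyMeasurable]
  refine ((integrable_upperMat_pow_four hδ hα k m).add
    (integrable_upperMat_pow_four hδ hα k n)).mono'
    ((measurable_upperMat_mul k m n).pow_const 2).aestronglyMeasurable (ae_of_all _ fun l => ?_)
  rw [Real.norm_of_nonneg (by positivity)]
  simp only [Pi.add_apply]
  nlinarith [sq_nonneg (upperMat l k m ^ 2 - upperMat l k n ^ 2), sq_nonneg (upperMat l k m ^ 2),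
    sq_nonneg (upperMat l k n ^ 2)]

lemma integral_upperMat_mul (hδ : 0 < δ) (hα : 0 < alphaC δ 5) (k m n : Fin 6) :
    ∫ l, upperMat l k m * upperMat l k n ∂factorLaw δ =
      if m = n then sigmaC δ ^ 2 * rowScale δ k m else 0 := by
  split_ifs with h
  · subst h
    simp_rw [← sq]
    exact integral_upperMat_sq hδ hα k m
  · rw [(indepFun_upperMat hδ hα k h).integral_fun_mul_eq_mul_integral
      (measurable_upperMat k m).aestronglyMeasurable (measurable_upperMat k n).aestronglyMeasurable]
    -- At most one of the two entries of row `k` is diagonal, so the other has mean zero.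
    rcases eq_or_ne k m with h' | h'
    · rw [integral_upperMat_of_ne hδ hα (k := k) (m := n) (h' ▸ h), mul_zero]
    · rw [integral_upperMat_of_ne hδ hα h', zero_mul]

lemma variance_upperMat_mul (hδ : 0 < δ) (hα : 0 < alphaC δ 5) (k m n : Fin 6) :
    variance (fun l => upperMat l k m * upperMat l k n) (factorLaw δ) =
      sigmaC δ ^ 4 * if m = n then 2 * rowScale δ k m else rowScale δ k m * rowScale δ k n := by
  have := isProbabilityMeasure_factorLaw hδ hα
  rw [variance_eq_sub (memLp_upperMat_mul hδ hα k m n), integral_upperMat_mul hδ hα]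
  simp only [Pi.pow_apply, mul_pow]
  split_ifs with h
  · subst h
    simp_rw [← pow_add]
    rw [integral_upperMat_pow_four hδ hα]
    ring
  · have hi := (indepFun_upperMat hδ hα k h).comp (φ := fun x => x ^ 2) (ψ := fun x => x ^ 2)
      (by fun_prop) (by fun_prop)
    have h2 := hi.integral_fun_mul_eq_mul_integral
      ((measurable_upperMat k m).pow_const 2).aestronglyMeasurable
      ((measurable_upperMat k n).pow_const 2).aestronglyMeasurable
    simp only [Function.comp_apply] at h2
    rw [h2, integral_upperMat_sq hδ hα, integral_upperMat_sq hδ hα]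
    ring

lemma gram_apply (l : UT → ℝ) (m n : Fin 6) :
    ((upperMat l).transpose * upperMat l) m n = ∑ k, upperMat l k m * upperMat l k n := by
  simp only [Matrix.mul_apply, Matrix.transpose_apply]

lemma memLp_gram (hδ : 0 < δ) (hα : 0 < alphaC δ 5) (m n : Fin 6) :
    MemLp (fun l => ((upperMat l).transpose * upperMat l) m n) 2 (factorLaw δ) := by
  simp_rw [gram_apply]
  exact memLp_finsetSum _ fun k _ => memLp_upperMat_mul hδ hα k m n

lemma integral_gram (hδ : 0 < δ) (hα : 0 < alphaC δ 5) (m n : Fin 6) :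
    ∫ l, ((upperMat l).transpose * upperMat l) m n ∂factorLaw δ = (1 : M6) m n := by
  have := isProbabilityMeasure_factorLaw hδ hα
  simp_rw [gram_apply]
  rw [integral_finsetSum _ fun k _ => (memLp_upperMat_mul hδ hα k m n).integrable one_le_two]
  simp_rw [integral_upperMat_mul hδ hα]
  rw [Matrix.one_apply]
  split_ifs with h
  · rw [← Finset.mul_sum, sum_rowScale, ← two_rate_sigma hδ]
    ring
  · simp

/-- The rows contribute independent summands, so variances add; `2 * rate δ * σ² = 1` then lowers
`σ⁴` to `σ²`. -/
lemma variance_gram (hδ : 0 < δ) (hα : 0 < alphaC δ 5) (m n : Fin 6) :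
    variance (fun l => ((upperMat l).transpose * upperMat l) m n) (factorLaw δ) =
      sigmaC δ ^ 2 * if m = n then 2 else 1 := by
  have h1 : (fun l => ((upperMat l).transpose * upperMat l) m n) =
      ∑ k, fun l => upperMat l k m * upperMat l k n := by
    ext l
    simp [gram_apply]
  rw [h1, IndepFun.variance_sum (fun k _ => memLp_upperMat_mul hδ hα k m n)
    fun k _ k' _ hk => indepFun_upperMat_mul hδ hα hk m n]
  simp_rw [variance_upperMat_mul hδ hα]
  rw [← Finset.mul_sum]
  have h2 := two_rate_sigma hδ
  rcases lt_trichotomy m n with h | h | h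
  · simp only [h.ne, if_false]
    rw [sum_rowScale_mul h]
    linear_combination sigmaC δ ^ 2 * h2
  · simp only [h, if_true]
    rw [← Finset.mul_sum, sum_rowScale]
    linear_combination 2 * sigmaC δ ^ 2 * h2
  · simp only [h.ne', if_false]
    simp_rw [mul_comm (rowScale δ _ m)]
    rw [sum_rowScale_mul h]
    linear_combination sigmaC δ ^ 2 * h2

lemma frobSq_eq (A : M6) : frobSq A = ∑ n, ∑ m, A m n ^ 2 := by
  simp only [frobSq, Matrix.trace, Matrix.diag_apply, Matrix.mul_apply, Matrix.transpose_apply, sq]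

lemma integrable_frobSq_gram (hδ : 0 < δ) (hα : 0 < alphaC δ 5) :
    Integrable (fun l => frobSq ((upperMat l).transpose * upperMat l - 1)) (factorLaw δ) := by
  have := isProbabilityMeasure_factorLaw hδ hα
  simp_rw [frobSq_eq]
  refine integrable_finsetSum _ fun n _ => integrable_finsetSum _ fun m _ => ?_
  exact ((memLp_gram hδ hα m n).sub (memLp_const ((1 : M6) m n))).integrable_sq

lemma integral_frobSq_gram (hδ : 0 < δ) (hα : 0 < alphaC δ 5) :
    ∫ l, frobSq ((upperMat l).transpose * upperMat l - 1) ∂factorLaw δ = 6 * δ ^ 2 := by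
  have := isProbabilityMeasure_factorLaw hδ hα
  have hi : ∀ m n, Integrable
      (fun l => ((upperMat l).transpose * upperMat l - 1) m n ^ 2) (factorLaw δ) := fun m n =>
    ((memLp_gram hδ hα m n).sub (memLp_const ((1 : M6) m n))).integrable_sq
  simp_rw [frobSq_eq]
  rw [integral_finsetSum _ fun n _ => integrable_finsetSum _ fun m _ => hi m n]
  have h : ∀ m n, ∫ l, ((upperMat l).transpose * upperMat l - 1) m n ^ 2 ∂factorLaw δ =
      sigmaC δ ^ 2 * if m = n then 2 else 1 := by
    intro m n
    rw [← variance_gram hδ hα, variance_eq_integral (memLp_gram hδ hα m n).aemeasurable,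
      integral_gram hδ hα]
    rfl
  -- In each column, one diagonal variance `2σ²` and five variances `σ²` add up to `7σ² = δ²`: this
  -- is why `σ = δ/√7`.
  have h2 : ∀ n, ∫ l, ∑ m, ((upperMat l).transpose * upperMat l - 1) m n ^ 2 ∂factorLaw δ =
      sigmaC δ ^ 2 * 7 := by
    intro n
    rw [integral_finsetSum _ fun m _ => hi m n]
    simp_rw [h]
    rw [← Finset.mul_sum]
    congr 1
    have h3 : ∀ m : Fin 6, (if m = n then (2 : ℝ) else 1) = (if m = n then 1 else 0) + 1 := by
      intro m
      split_ifs <;> norm_num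
    simp_rw [h3]
    rw [Finset.sum_add_distrib, Finset.sum_ite_eq' Finset.univ n]
    norm_num
  simp_rw [h2]
  rw [sigmaC_sq]
  simp

lemma ae_mem_cholCone (hδ : 0 < δ) (hα : 0 < alphaC δ 5) : ∀ᵐ l ∂factorLaw δ, l ∈ cholCone := by
  have := fun p => isProbabilityMeasure_entryLaw hδ hα p
  refine ae_all_iff.2 fun m => ?_
  exact Measure.tendsto_eval_ae_ae.eventually (ae_pos_entryLaw hδ m)

lemma log_det_gram {l : UT → ℝ} (hl : l ∈ cholCone) :
    Real.log ((upperMat l).transpose * upperMat l).det = ∑ m, Real.log (l (diagIdx m) ^ 2) := by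
  rw [det_gram, Real.log_prod fun m _ => (pow_pos (hl m) 2).ne']

/-- The value of `E log det C` under the explicit density. -/
def logDetMean (δ : ℝ) : ℝ := ∑ m, (meanLog (alphaC δ m) - Real.log (rate δ))

lemma integrable_log_det_gram (hδ : 0 < δ) (hα : 0 < alphaC δ 5) :
    Integrable (fun l => Real.log ((upperMat l).transpose * upperMat l).det) (factorLaw δ) := by
  refine (integrable_finsetSum Finset.univ fun m _ =>
    integrable_coord hδ hα (integrable_entry_log_sq hδ hα m)).congr ?_
  filter_upwards [ae_mem_cholCone hδ hα] with l hl
  rw [log_det_gram hl]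

lemma integral_log_det_gram (hδ : 0 < δ) (hα : 0 < alphaC δ 5) :
    ∫ l, Real.log ((upperMat l).transpose * upperMat l).det ∂factorLaw δ = logDetMean δ := by
  have h : (fun l => Real.log ((upperMat l).transpose * upperMat l).det) =ᵐ[factorLaw δ]
      fun l => ∑ m, Real.log (l (diagIdx m) ^ 2) := by
    filter_upwards [ae_mem_cholCone hδ hα] with l hl
    rw [log_det_gram hl]
  rw [integral_congr_ae h, integral_finsetSum _ fun m _ =>
    integrable_coord hδ hα (integrable_entry_log_sq hδ hα m), logDetMean]
  refine Finset.sum_congr rfl fun m _ => ?_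
  rw [integral_coord hδ hα (f := fun x => Real.log (x ^ 2)) (by fun_prop),
    integral_entry_log_sq hδ hα]

/-! ### The inverse matrix -/

/-- The Leibniz expansion has `6! = 720` terms. The hypothesis `1 ≤ K` covers the row replaced by a
basis vector. -/
lemma abs_adjugate_le {C : M6} {K : ℝ} (hK : 1 ≤ K) (hC : ∀ i j, |C i j| ≤ K) (i j : Fin 6) :
    |C.adjugate i j| ≤ 720 * K ^ 6 := by
  have h := Matrix.det_le (A := C.updateRow j (Pi.single i 1))
    (abv := (AbsoluteValue.abs : AbsoluteValue ℝ ℝ)) (x := K) (fun a b => by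
      simp only [AbsoluteValue.abs_apply, Matrix.updateRow_apply]
      split_ifs with h
      · rw [Pi.single_apply]
        split_ifs
        · simpa using hK
        · simp
          linarith
      · exact hC a b)
  rw [Matrix.adjugate_apply]
  simpa [Nat.factorial] using h

lemma frobSq_inv_le {C : M6} {K : ℝ} (hK : 1 ≤ K) (hC : ∀ i j, |C i j| ≤ K) :
    frobSq C⁻¹ ≤ 36 * (720 * K ^ 6) ^ 2 * (C.det ^ 2)⁻¹ := by
  have h : ∀ i j, C⁻¹ i j ^ 2 ≤ (720 * K ^ 6) ^ 2 * (C.det ^ 2)⁻¹ := by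
    intro i j
    rw [Matrix.inv_def, Matrix.smul_apply, Ring.inverse_eq_inv', smul_eq_mul, mul_pow, inv_pow,
      mul_comm]
    gcongr 1
    exact sq_le_sq' (by linarith [(abs_le.1 (abs_adjugate_le hK hC i j)).1])
      (abs_le.1 (abs_adjugate_le hK hC i j)).2
  rw [frobSq_eq]
  refine (Finset.sum_le_sum fun n _ => Finset.sum_le_sum fun m _ => h m n).trans_eq ?_
  simp
  ring

/-- A crude bound chosen to factorize over the independent entries. With `M = ∏ (1 + l p ^ 2)`, the
entries of `L` are at most `M` and those of `Lᵀ L` at most `6 M²`; the squared adjugate bound then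
gives `M ^ 24`, and the squared determinant gives the inverse fourth powers. -/
lemma frobSq_inv_gram_le (l : UT → ℝ) :
    frobSq ((upperMat l).transpose * upperMat l)⁻¹ ≤ (36 * 720 ^ 2 * 6 ^ 12) *
      ∏ p, ((1 + l p ^ 2) ^ 24 * if p.1.1 = p.1.2 then (l p ^ 4)⁻¹ else 1) := by
  set M := ∏ p, (1 + l p ^ 2) with hM
  have hM1 : 1 ≤ M := 
    Finset.prod_const_one.symm.trans_le (Finset.prod_le_prod (fun _ _ => zero_le_one)
      fun p _ => by linarith [sq_nonneg (l p)])
  have hlM : ∀ p, |l p| ≤ M := by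
    intro p
    have h1 : 1 + l p ^ 2 ≤ M := by
      rw [hM, ← Finset.mul_prod_erase _ _ (Finset.mem_univ p)]
      refine le_mul_of_one_le_right (by positivity) ?_
      exact Finset.prod_const_one.symm.trans_le (Finset.prod_le_prod (fun _ _ => zero_le_one)
        fun p _ => by linarith [sq_nonneg (l p)])
    have h2 : |l p| ≤ 1 + l p ^ 2 := by
      rw [← sq_abs (l p)]
      nlinarith [sq_nonneg (|l p| - 1), abs_nonneg (l p)]
    exact h2.trans h1
  have hU : ∀ k m, |upperMat l k m| ≤ M := by
    intro k m
    rcases le_or_gt k m with h | h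
    · rw [upperMat_of_le _ h]
      exact hlM _
    · rw [upperMat_of_lt _ h, abs_zero]
      linarith
  have hC : ∀ i j, |((upperMat l).transpose * upperMat l) i j| ≤ 6 * M ^ 2 := by
    intro i j
    rw [gram_apply]
    refine (Finset.abs_sum_le_sum_abs _ _).trans ?_
    have : ∀ k ∈ Finset.univ, |upperMat l k i * upperMat l k j| ≤ M ^ 2 := by
      intro k _
      rw [abs_mul, sq]
      exact mul_le_mul (hU k i) (hU k j) (abs_nonneg _) (by linarith)
    refine (Finset.sum_le_sum this).trans_eq ?_
    simp
  refine (frobSq_inv_le (by nlinarith) hC).trans_eq ?_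
  have hd : ∏ p : UT, (if p.1.1 = p.1.2 then (l p ^ 4)⁻¹ else 1) =
      ∏ m, (l (diagIdx m) ^ 4)⁻¹ := by
    rw [← prod_UT_diag fun m => (l (diagIdx m) ^ 4)⁻¹]
    refine Finset.prod_congr rfl fun p _ => ?_
    split_ifs with h
    · rw [← eq_diagIdx h]
    · rfl
  have hdet : ((upperMat l).transpose * upperMat l).det ^ 2 = ∏ m, l (diagIdx m) ^ 4 := by
    rw [det_gram, ← Finset.prod_pow]
    exact Finset.prod_congr rfl fun m _ => by ring
  rw [Finset.prod_mul_distrib, hd, Finset.prod_pow, ← hM, Finset.prod_inv_distrib, hdet]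
  ring

lemma measurable_inv_entry (m n : Fin 6) : Measurable fun C : M6 => C⁻¹ m n := by
  have h1 : Measurable fun C : M6 => C.adjugate m n := by
    rw [funext fun C : M6 => Matrix.adjugate_apply C m n]
    have h2 : Measurable fun C : M6 => C.updateRow n (Pi.single m 1) := by
      refine measurable_of_entries fun i j => ?_
      by_cases h : i = n
      · simp only [Matrix.updateRow_apply, h, if_true]
        exact measurable_const
      · simp only [Matrix.updateRow_apply, h, if_false]
        exact measurable_entry i j
    have h3 := measurable_det.comp h2
    rw [Function.comp_def] at h3
    exact h3
  simp_rw [Matrix.inv_def, Matrix.smul_apply, Ring.inverse_eq_inv', smul_eq_mul]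
  exact measurable_det.inv.mul h1

lemma measurable_frobSq : Measurable frobSq := by
  rw [funext frobSq_eq]
  exact Finset.measurable_sum _ fun n _ => Finset.measurable_sum _ fun m _ =>
    (measurable_entry m n).pow_const 2

lemma frobSq_nonneg (A : M6) : 0 ≤ frobSq A := by
  rw [frobSq_eq]
  positivity

lemma measurable_frobSq_inv : Measurable fun C : M6 => frobSq C⁻¹ :=
  measurable_frobSq.comp (measurable_of_entries measurable_inv_entry)

lemma integrable_frobSq_inv_gram (hδ : 0 < δ) (hα : 2 < alphaC δ 5) :
    Integrable (fun l => frobSq ((upperMat l).transpose * upperMat l)⁻¹) (factorLaw δ) := by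
  have := fun p => isProbabilityMeasure_entryLaw hδ (by linarith) p
  have h := Integrable.fintype_prod (μ := entryLaw δ) fun p => integrable_entry_inverse hδ hα 24 p
  refine (h.const_mul (36 * 720 ^ 2 * 6 ^ 12)).mono'
    (measurable_frobSq_inv.comp measurable_gram).aestronglyMeasurable (ae_of_all _ fun l => ?_)
  rw [Real.norm_of_nonneg (frobSq_nonneg _)]
  exact frobSq_inv_gram_le l

end Moments

/-! ### Moments under the explicit density -/

section Density

variable {δ : ℝ}

lemma integrable_densityLaw_iff (hδ : 0 < δ) (hα : 0 < alphaC δ 5) {f : M6 → ℝ}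
    (hf : Measurable f) : Integrable f (densityLaw (pdfC δ)) ↔
      Integrable (fun l => f ((upperMat l).transpose * upperMat l)) (factorLaw δ) := by
  rw [← map_gram_factorLaw hδ hα, integrable_map_measure hf.aestronglyMeasurable
    measurable_gram.aemeasurable]
  rfl

lemma integral_densityLaw (hδ : 0 < δ) (hα : 0 < alphaC δ 5) {f : M6 → ℝ}
    (hf : Measurable f) : ∫ C, f C ∂densityLaw (pdfC δ) =
      ∫ l, f ((upperMat l).transpose * upperMat l) ∂factorLaw δ := by
  rw [← map_gram_factorLaw hδ hα, integral_map measurable_gram.aemeasurable hf.aestronglyMeasurable]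

lemma measurable_log_det : Measurable fun C : M6 => Real.log C.det :=
  Real.measurable_log.comp measurable_det

lemma measurable_frobSq_sub_one : Measurable fun C : M6 => frobSq (C - 1) :=
  measurable_frobSq.comp (measurable_of_entries fun m n => (measurable_entry m n).sub_const _)

lemma isAdmissibleDensity_pdfC (hδ : 0 < δ) (hα : 0 < alphaC δ 5) :
    IsAdmissibleDensity (logDetMean δ) (pdfC δ) where
  measurable := (measurable_unnormalizedPdf δ).const_mul _
  nonneg C := mul_nonneg (normConst_pos hδ hα).le (unnormalizedPdf_nonneg δ C)
  support C hC := by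
    rw [pdfC, unnormalizedPdf, Set.indicator_of_notMem (by exact hC), mul_zero]
  prob := isProbabilityMeasure_densityLaw_pdfC hδ hα
  mean_integrable m n := by
    have := isProbabilityMeasure_factorLaw hδ hα
    rw [integrable_densityLaw_iff hδ hα (measurable_entry m n)]
    exact (memLp_gram hδ hα m n).integrable one_le_two
  mean m n := by
    rw [integral_densityLaw hδ hα (measurable_entry m n), integral_gram hδ hα]
  logdet_integrable := by
    rw [integrable_densityLaw_iff hδ hα measurable_log_det]
    exact integrable_log_det_gram hδ hα
  logdet := by
    rw [integral_densityLaw hδ hα measurable_log_det, integral_log_det_gram hδ hα]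

lemma hasFluctuationLevel_pdfC (hδ : 0 < δ) (hα : 0 < alphaC δ 5) :
    HasFluctuationLevel (densityLaw (pdfC δ)) (fun C => C) δ := by
  refine ⟨?_, ?_⟩
  · rw [integrable_densityLaw_iff hδ hα measurable_frobSq_sub_one]
    exact integrable_frobSq_gram hδ hα
  · rw [integral_densityLaw hδ hα measurable_frobSq_sub_one, integral_frobSq_gram hδ hα,
      mul_div_cancel_left₀ _ (by norm_num), Real.sqrt_sq hδ.le]

lemma integrable_frobSq_inv_pdfC (hδ : 0 < δ) (hα : 2 < alphaC δ 5) :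
    Integrable (fun C : M6 => frobSq C⁻¹) (densityLaw (pdfC δ)) := by
  rw [integrable_densityLaw_iff hδ (by linarith) measurable_frobSq_inv]
  exact integrable_frobSq_inv_gram hδ hα

end Density

/-! ### The Gibbs inequality -/

/-- The positive part of `u` is dominated by that of `g`, so the difference is never `∞ - ∞`. If the
negative part diverges the value is `⊥`, and equality is impossible; otherwise `u` is integrable,
and `g - u ≥ 0` with zero integral vanishes almost everywhere. -/
lemma lintegral_sub_lintegral_le {X : Type*} [MeasurableSpace X] {ν : Measure X} {u g : X → ℝ}
    (hu : Measurable u) (hg : Integrable g ν) (hug : ∀ x, u x ≤ g x) :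
    ((∫⁻ x, ENNReal.ofReal (u x) ∂ν : ℝ≥0∞) : EReal) - (∫⁻ x, ENNReal.ofReal (-u x) ∂ν : ℝ≥0∞) ≤
      ((∫ x, g x ∂ν : ℝ) : EReal) ∧
    (((∫⁻ x, ENNReal.ofReal (u x) ∂ν : ℝ≥0∞) : EReal) - (∫⁻ x, ENNReal.ofReal (-u x) ∂ν : ℝ≥0∞) =
      ((∫ x, g x ∂ν : ℝ) : EReal) → u =ᵐ[ν] g) := by
  have hfin : ∫⁻ x, ENNReal.ofReal (u x) ∂ν ≠ ∞ := by
    refine ne_top_of_le_ne_top ?_ (lintegral_mono fun x => ENNReal.ofReal_le_ofReal (hug x))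
    exact hg.lintegral_lt_top.ne
  by_cases hneg : ∫⁻ x, ENNReal.ofReal (-u x) ∂ν = ∞
  · rw [hneg]
    have h : ((∫⁻ x, ENNReal.ofReal (u x) ∂ν : ℝ≥0∞) : EReal) - ((∞ : ℝ≥0∞) : EReal) = ⊥ := by
      rw [EReal.coe_ennreal_top, EReal.sub_top]
    rw [h]
    exact ⟨bot_le, fun h' => absurd h'.symm (EReal.coe_ne_bot _)⟩
  · have hint : Integrable u ν := by
      refine ⟨hu.aestronglyMeasurable, ?_⟩
      rw [hasFiniteIntegral_iff_norm]
      have : ∀ x, ENNReal.ofReal ‖u x‖ ≤ ENNReal.ofReal (u x) + ENNReal.ofReal (-u x) := by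
        intro x
        rcases le_total 0 (u x) with h | h
        · rw [Real.norm_of_nonneg h]
          exact le_self_add
        · rw [Real.norm_of_nonpos h]
          exact le_add_self
      refine (lintegral_mono this).trans_lt ?_
      rw [lintegral_add_left hu.ennreal_ofReal]
      exact ENNReal.add_lt_top.2 ⟨hfin.lt_top, Ne.lt_top hneg⟩
    have heq : ((∫⁻ x, ENNReal.ofReal (u x) ∂ν : ℝ≥0∞) : EReal) -
        (∫⁻ x, ENNReal.ofReal (-u x) ∂ν : ℝ≥0∞) = ((∫ x, u x ∂ν : ℝ) : EReal) := by
      rw [integral_eq_lintegral_pos_part_sub_lintegral_neg_part hint, EReal.coe_sub,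
        EReal.coe_ennreal_toReal hfin, EReal.coe_ennreal_toReal hneg]
    rw [heq]
    refine ⟨EReal.coe_le_coe_iff.2 (integral_mono hint hg hug), fun h => ?_⟩
    have h0 : ∫ x, (g x - u x) ∂ν = 0 := by
      rw [integral_sub hg hint, sub_eq_zero]
      exact (EReal.coe_eq_coe_iff.1 h).symm
    rw [integral_eq_zero_iff_of_nonneg (fun x => sub_nonneg.2 (hug x)) (hg.sub hint)] at h0
    filter_upwards [h0] with x hx
    simp only [Pi.zero_apply, sub_eq_zero] at hx
    exact hx.symm

/-- `log t ≤ t - 1` at `t = p / q`, multiplied by `q`. -/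
lemma negMulLog_le {p q : ℝ} (hp : 0 < p) (hq : 0 ≤ q) :
    Real.negMulLog q ≤ -(q * Real.log p) + p - q := by
  rcases hq.eq_or_lt with rfl | hq
  · simpa using hp.le
  · have h := Real.log_le_sub_one_of_pos (div_pos hp hq)
    rw [Real.log_div hp.ne' hq.ne'] at h
    have h2 := mul_le_mul_of_nonneg_left h hq.le
    have h3 : q * (p / q - 1) = p - q := by field_simp
    rw [Real.negMulLog]
    linarith

lemma eq_of_negMulLog_eq {p q : ℝ} (hp : 0 < p) (hq : 0 ≤ q)
    (h : Real.negMulLog q = -(q * Real.log p) + p - q) : q = p := by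
  rcases hq.eq_or_lt with rfl | hq
  · simp at h
    exact h
  · by_contra hne
    have h1 := Real.log_lt_sub_one_of_pos (div_pos hp hq) (fun h' => hne (by
      rw [div_eq_one_iff_eq hq.ne'] at h'
      exact h'.symm))
    rw [Real.log_div hp.ne' hq.ne'] at h1
    have h2 := mul_lt_mul_of_pos_left h1 hq
    have h3 : q * (p / q - 1) = p - q := by field_simp
    rw [Real.negMulLog] at h
    linarith

/-- The exponent of the determinant in the explicit density. -/
def detExp (δ : ℝ) : ℝ := 7 * (1 - δ ^ 2) / (2 * δ ^ 2)

/-- The logarithm of the explicit density. -/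
def logPdf (δ : ℝ) (C : M6) : ℝ :=
  Real.log (normConst δ) + detExp δ * Real.log C.det - rate δ * C.trace

section Gibbs

variable {δ : ℝ} {q : M6 → ℝ}

lemma pdfC_pos (hδ : 0 < δ) (hα : 0 < alphaC δ 5) {C : M6} (hC : C.PosDef) : 0 < pdfC δ C := by
  have h1 := normConst_pos hδ hα
  have h2 : 0 < C.det := hC.det_pos
  rw [pdfC, unnormalizedPdf, Set.indicator_of_mem (by exact hC)]
  positivity

lemma log_pdfC (hδ : 0 < δ) (hα : 0 < alphaC δ 5) {C : M6} (hC : C.PosDef) :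
    Real.log (pdfC δ C) = logPdf δ C := by
  have h1 := normConst_pos hδ hα
  have h2 : 0 < C.det := hC.det_pos
  rw [pdfC, unnormalizedPdf, Set.indicator_of_mem (by exact hC), Real.log_mul h1.ne'
    (by positivity), Real.log_mul (by positivity) (by positivity), Real.log_rpow h2, Real.log_exp,
    logPdf, detExp, rate]
  ring

lemma integrable_densityLaw_iff_mul {b : ℝ} (hq : IsAdmissibleDensity b q) {f : M6 → ℝ} :
    Integrable f (densityLaw q) ↔ Integrable (fun C => q C * f C) symVolume := by
  rw [densityLaw, integrable_withDensity_iff_integrable_smul' hq.measurable.ennreal_ofReal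
    (ae_of_all _ fun _ => ENNReal.ofReal_lt_top)]
  simp_rw [ENNReal.toReal_ofReal (hq.nonneg _), smul_eq_mul]

lemma integral_densityLaw_eq_mul {b : ℝ} (hq : IsAdmissibleDensity b q) (f : M6 → ℝ) :
    ∫ C, f C ∂densityLaw q = ∫ C, q C * f C ∂symVolume := by
  rw [densityLaw, integral_withDensity_eq_integral_toReal_smul hq.measurable.ennreal_ofReal
    (ae_of_all _ fun _ => ENNReal.ofReal_lt_top)]
  simp_rw [ENNReal.toReal_ofReal (hq.nonneg _), smul_eq_mul]

lemma integrable_trace {b : ℝ} (hq : IsAdmissibleDensity b q) :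
    Integrable (fun C : M6 => C.trace) (densityLaw q) :=
  integrable_finsetSum _ fun m _ => hq.mean_integrable m m

lemma integral_trace {b : ℝ} (hq : IsAdmissibleDensity b q) :
    ∫ C : M6, C.trace ∂densityLaw q = 6 := by
  simp only [Matrix.trace, Matrix.diag_apply]
  rw [integral_finsetSum _ fun m _ => hq.mean_integrable m m]
  simp [hq.mean]

lemma integrable_logPdf {b : ℝ} (hq : IsAdmissibleDensity b q) (δ : ℝ) :
    Integrable (logPdf δ) (densityLaw q) := by
  have := hq.prob
  exact ((integrable_const _).add (hq.logdet_integrable.const_mul _)).sub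
    ((integrable_trace hq).const_mul _)

/-- The value depends on `q` only through the constraints; this makes the exponential form of the
density optimal. -/
lemma integral_logPdf {b : ℝ} (hq : IsAdmissibleDensity b q) (δ : ℝ) :
    ∫ C, logPdf δ C ∂densityLaw q = Real.log (normConst δ) + detExp δ * b - rate δ * 6 := by
  have := hq.prob
  unfold logPdf
  rw [integral_sub, integral_add, integral_const_mul, integral_const_mul, integral_trace hq,
    hq.logdet]
  · simp
  · exact integrable_const _
  · exact hq.logdet_integrable.const_mul _
  · exact (integrable_const _).add (hq.logdet_integrable.const_mul _)
  · exact (integrable_trace hq).const_mul _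

lemma integrable_density {b : ℝ} (hq : IsAdmissibleDensity b q) : Integrable q symVolume := by
  have := hq.prob
  simpa using (integrable_densityLaw_iff_mul hq).1 (integrable_const (1 : ℝ))

lemma integral_density {b : ℝ} (hq : IsAdmissibleDensity b q) : ∫ C, q C ∂symVolume = 1 := by
  have := hq.prob
  simpa using (integral_densityLaw_eq_mul hq fun _ => (1 : ℝ)).symm

/-- The integrable upper bound of `- q log q` in the Gibbs inequality. -/
def gibbsBound (δ : ℝ) (q : M6 → ℝ) (C : M6) : ℝ := -(q C * logPdf δ C) + pdfC δ C - q C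

lemma negMulLog_le_gibbsBound (hδ : 0 < δ) (hα : 0 < alphaC δ 5) {b : ℝ}
    (hq : IsAdmissibleDensity b q) (C : M6) : Real.negMulLog (q C) ≤ gibbsBound δ q C := by
  by_cases hC : C.PosDef
  · have := negMulLog_le (pdfC_pos hδ hα hC) (hq.nonneg C)
    rwa [log_pdfC hδ hα hC] at this
  · rw [gibbsBound, hq.support C hC, (isAdmissibleDensity_pdfC hδ hα).support C hC]
    simp

lemma negMulLog_pdfC (hδ : 0 < δ) (hα : 0 < alphaC δ 5) (C : M6) :
    Real.negMulLog (pdfC δ C) = gibbsBound δ (pdfC δ) C := by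
  by_cases hC : C.PosDef
  · rw [gibbsBound, ← log_pdfC hδ hα hC, Real.negMulLog]
    ring
  · rw [gibbsBound, (isAdmissibleDensity_pdfC hδ hα).support C hC]
    simp

lemma integrable_gibbsBound (hδ : 0 < δ) (hα : 0 < alphaC δ 5) {b : ℝ}
    (hq : IsAdmissibleDensity b q) : Integrable (gibbsBound δ q) symVolume :=
  (((integrable_densityLaw_iff_mul hq).1 (integrable_logPdf hq δ)).neg.add
    (integrable_density (isAdmissibleDensity_pdfC hδ hα))).sub (integrable_density hq)

lemma integral_gibbsBound (hδ : 0 < δ) (hα : 0 < alphaC δ 5) {b : ℝ}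
    (hq : IsAdmissibleDensity b q) : ∫ C, gibbsBound δ q C ∂symVolume =
      -(Real.log (normConst δ) + detExp δ * b - rate δ * 6) := by
  have hp := isAdmissibleDensity_pdfC hδ hα
  have h1 : Integrable (fun C => -(q C * logPdf δ C)) symVolume :=
    ((integrable_densityLaw_iff_mul hq).1 (integrable_logPdf hq δ)).neg
  have h2 : Integrable (fun C => -(q C * logPdf δ C) + pdfC δ C) symVolume :=
    h1.add (integrable_density hp)
  unfold gibbsBound
  rw [integral_sub h2 (integrable_density hq), integral_add h1 (integrable_density hp),
    integral_neg, ← integral_densityLaw_eq_mul hq,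
    integral_logPdf hq, integral_density hp, integral_density hq]
  ring

lemma entropy_pdfC (hδ : 0 < δ) (hα : 0 < alphaC δ 5) : entropy (pdfC δ) =
    ((-(Real.log (normConst δ) + detExp δ * logDetMean δ - rate δ * 6) : ℝ) : EReal) := by
  have hp := isAdmissibleDensity_pdfC hδ hα
  have hi := integrable_gibbsBound hδ hα hp
  rw [← integral_gibbsBound hδ hα hp, entropy]
  simp_rw [negMulLog_pdfC hδ hα]
  have h1 : ∫⁻ C, ENNReal.ofReal (gibbsBound δ (pdfC δ) C) ∂symVolume ≠ ∞ := hi.lintegral_lt_top.ne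
  have h2 : ∫⁻ C, ENNReal.ofReal (-gibbsBound δ (pdfC δ) C) ∂symVolume ≠ ∞ :=
    hi.neg.lintegral_lt_top.ne
  rw [integral_eq_lintegral_pos_part_sub_lintegral_neg_part hi, EReal.coe_sub,
    EReal.coe_ennreal_toReal h1, EReal.coe_ennreal_toReal h2]

lemma entropy_le (hδ : 0 < δ) (hα : 0 < alphaC δ 5)
    (hq : IsAdmissibleDensity (logDetMean δ) q) : entropy q ≤ entropy (pdfC δ) := by
  rw [entropy_pdfC hδ hα, ← integral_gibbsBound hδ hα hq]
  exact (lintegral_sub_lintegral_le (Real.continuous_negMulLog.measurable.comp hq.measurable)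
    (integrable_gibbsBound hδ hα hq) (negMulLog_le_gibbsBound hδ hα hq)).1

lemma isMaxEntDensity_pdfC (hδ : 0 < δ) (hα : 0 < alphaC δ 5) :
    IsMaxEntDensity (logDetMean δ) (pdfC δ) :=
  ⟨isAdmissibleDensity_pdfC hδ hα, fun _ hq => entropy_le hδ hα hq⟩

/-- Uniqueness of the law of maximal entropy. -/
lemma densityLaw_eq_of_isMaxEntDensity (hδ : 0 < δ) (hα : 0 < alphaC δ 5)
    (hq : IsMaxEntDensity (logDetMean δ) q) : densityLaw q = densityLaw (pdfC δ) := by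
  have h : entropy q = entropy (pdfC δ) :=
    le_antisymm (entropy_le hδ hα hq.1) (hq.2 _ (isAdmissibleDensity_pdfC hδ hα))
  rw [entropy_pdfC hδ hα, ← integral_gibbsBound hδ hα hq.1] at h
  -- Equal entropies are the equality case of the Gibbs bound, which then holds almost everywhere
  -- and forces the two densities to agree.
  have h2 := (lintegral_sub_lintegral_le
    (Real.continuous_negMulLog.measurable.comp hq.1.measurable)
    (integrable_gibbsBound hδ hα hq.1) (negMulLog_le_gibbsBound hδ hα hq.1)).2 h
  refine withDensity_congr_ae ?_
  filter_upwards [h2] with C hC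
  by_cases hpd : C.PosDef
  · have h3 : Real.negMulLog (q C) = gibbsBound δ q C := hC
    rw [gibbsBound, ← log_pdfC hδ hα hpd] at h3
    rw [eq_of_negMulLog_eq (pdfC_pos hδ hα hpd) (hq.1.nonneg C) h3]
  · rw [hq.1.support C hpd, (isAdmissibleDensity_pdfC hδ hα).support C hpd]

end Gibbs

/-! ### The mean of the logarithm of a Gamma variable -/

lemma integral_gammaMeasure {α : ℝ} (hα : 0 < α) (f : ℝ → ℝ) :
    ∫ y, f y ∂gammaMeasure α 1 =
      (∫ y in Set.Ioi (0 : ℝ), y ^ (α - 1) * (f y * Real.exp (-y))) / Real.Gamma α := by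
  have h1 : ∀ y, (gammaPDF α 1 y).toReal = gammaPDFReal α 1 y := fun y => by
    rw [gammaPDF, ENNReal.toReal_ofReal (gammaPDFReal_nonneg hα one_pos y)]
  rw [gammaMeasure, integral_withDensity_eq_integral_toReal_smul (by unfold gammaPDF; fun_prop)
    (ae_of_all _ fun y => by simp [gammaPDF]), div_eq_mul_inv, ← integral_mul_const,
    ← integral_indicator measurableSet_Ioi]
  refine integral_congr_ae ?_
  filter_upwards [Measure.ae_ne volume (0 : ℝ)] with y hy
  rw [h1, smul_eq_mul]
  rcases hy.lt_or_gt with h | h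
  · simp [gammaPDFReal, h.not_ge, h.not_gt]
  · rw [Set.indicator_of_mem (by exact h), gammaPDFReal, if_pos h.le, Real.one_rpow]
    ring_nf

/-- Differentiation under Euler's integral, taken from the complex Gamma function: `meanLog` is the
digamma function. -/
lemma hasDerivAt_Gamma_real {α : ℝ} (hα : 0 < α) :
    HasDerivAt Real.Gamma (meanLog α * Real.Gamma α) α := by
  have h1 := Complex.hasDerivAt_GammaIntegral (s := (α : ℂ)) (by simpa using hα)
  have h2 : HasDerivAt Complex.Gamma
      (∫ t : ℝ in Set.Ioi 0, (t : ℂ) ^ ((α : ℂ) - 1) * (Real.log t * Real.exp (-t))) (α : ℂ) := by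
    refine h1.congr_of_eventuallyEq ?_
    have : ∀ᶠ z : ℂ in 𝓝 (α : ℂ), 0 < z.re :=
      (Complex.continuous_re.tendsto _).eventually (lt_mem_nhds (by simpa using hα))
    filter_upwards [this] with z hz
    exact Complex.Gamma_eq_integral hz
  have h3 := h2.real_of_complex
  have h4 : (∫ t : ℝ in Set.Ioi 0, (t : ℂ) ^ ((α : ℂ) - 1) * (Real.log t * Real.exp (-t))).re =
      meanLog α * Real.Gamma α := by
    rw [meanLog, integral_gammaMeasure hα, div_mul_cancel₀ _ (Real.Gamma_pos_of_pos hα).ne']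
    rw [← Complex.ofReal_re (∫ y in Set.Ioi (0 : ℝ), y ^ (α - 1) * (Real.log y * Real.exp (-y))),
      ← integral_complex_ofReal]
    congr 1
    refine setIntegral_congr_fun measurableSet_Ioi fun t ht => ?_
    have ht : 0 < t := ht
    push_cast
    rw [Complex.ofReal_cpow ht.le]
    push_cast
    rfl
  rw [h4] at h3
  exact h3

lemma hasDerivAt_log_Gamma {α : ℝ} (hα : 0 < α) :
    HasDerivAt (fun x => Real.log (Real.Gamma x)) (meanLog α) α := by
  have h := (hasDerivAt_Gamma_real hα).log (Real.Gamma_pos_of_pos hα).ne'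
  rwa [mul_div_cancel_right₀ _ (Real.Gamma_pos_of_pos hα).ne'] at h

/-- Jensen's inequality, by integrating the tangent line of `log` at the mean `α`. -/
lemma meanLog_le {α : ℝ} (hα : 0 < α) : meanLog α ≤ Real.log α := by
  have := isProbabilityMeasure_gammaMeasure hα one_pos
  have h1 : ∫ y, (y / α - 1 + Real.log α) ∂gammaMeasure α 1 = Real.log α := by
    rw [integral_add, integral_sub, integral_div, integral_gammaMeasure_id hα]
    · simp [hα.ne']
    · exact (integrable_gammaMeasure_id hα).div_const _
    · exact integrable_const _
    · exact ((integrable_gammaMeasure_id hα).div_const _).sub (integrable_const _)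
    · exact integrable_const _
  rw [← h1, meanLog]
  refine integral_mono_ae (integrable_log_gammaMeasure hα)
    ((((integrable_gammaMeasure_id hα).div_const _).sub (integrable_const _)).add
      (integrable_const _)) ?_
  filter_upwards [ae_pos_gammaMeasure α] with y hy
  have := Real.log_le_sub_one_of_pos (div_pos hy hα)
  rw [Real.log_div hy.ne' hα.ne'] at this
  linarith

/-- Jensen's inequality for the reciprocal variable, whose mean is `1 / (α - 1)`. -/
lemma le_meanLog {α : ℝ} (hα : 1 < α) : Real.log (α - 1) ≤ meanLog α := by
  have hα0 : 0 < α := by linarith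
  have hα1 : 0 < α - 1 := by linarith
  have := isProbabilityMeasure_gammaMeasure hα0 one_pos
  have hi := integrable_rpow_gammaMeasure hα0 (s := -1) (by linarith)
  have hm : ∫ y, y ^ (-1 : ℝ) ∂gammaMeasure α 1 = (α - 1)⁻¹ := by
    rw [integral_rpow_gammaMeasure hα0 (by linarith), ← sub_eq_add_neg]
    have h := Real.Gamma_add_one hα1.ne'
    rw [sub_add_cancel] at h
    rw [h]
    have := (Real.Gamma_pos_of_pos hα1).ne'
    field_simp
  have h1 : ∫ y, (Real.log (α - 1) + 1 - (α - 1) * y ^ (-1 : ℝ)) ∂gammaMeasure α 1 =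
      Real.log (α - 1) := by
    rw [integral_sub (integrable_const _) (hi.const_mul _), integral_const_mul, hm,
      mul_inv_cancel₀ hα1.ne']
    simp
  rw [← h1, meanLog]
  refine integral_mono_ae ((integrable_const _).sub (hi.const_mul _))
    (integrable_log_gammaMeasure hα0) ?_
  filter_upwards [ae_pos_gammaMeasure α] with y hy
  have := Real.log_le_sub_one_of_pos (div_pos hα1 hy)
  rw [Real.log_div hα1.ne' hy.ne'] at this
  rw [Real.rpow_neg_one, ← div_eq_mul_inv]
  linarith

/-- `E log det C` as a function of the rate. -/
def logDetOfRate (a : ℝ) : ℝ := ∑ m : Fin 6, (meanLog (a - (m : ℕ) / 2) - Real.log a)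

lemma logDetMean_eq (δ : ℝ) : logDetMean δ = logDetOfRate (rate δ) := by
  simp only [logDetMean, logDetOfRate, alphaC_eq]

lemma cast_fin_le (m : Fin 6) : ((m : ℕ) : ℝ) ≤ 5 := by
  exact_mod_cast Nat.le_of_lt_succ m.2

/-- Exhibiting `logDetOfRate` as a derivative lets Darboux's theorem supply intermediate values,
with no continuity of `meanLog` needed. -/
lemma hasDerivAt_logDetOfRate {a : ℝ} (ha : 5 / 2 < a) :
    HasDerivAt (fun x => ∑ m : Fin 6, (Real.log (Real.Gamma (x - (m : ℕ) / 2)) -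
      (x * Real.log x - x))) (logDetOfRate a) a := by
  refine HasDerivAt.fun_sum fun m _ => ?_
  have hm := cast_fin_le m
  have h1 : HasDerivAt (fun x => Real.log (Real.Gamma (x - (m : ℕ) / 2)))
      (meanLog (a - (m : ℕ) / 2)) a :=
    HasDerivAt.comp_sub_const a _ (hasDerivAt_log_Gamma (by linarith))
  have h2 : HasDerivAt (fun x => x * Real.log x - x) (Real.log a) a := by
    have := (Real.hasDerivAt_mul_log (x := a) (by linarith)).sub (hasDerivAt_id a)
    rw [add_sub_cancel_right] at this
    exact this
  exact h1.sub h2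

lemma exists_logDetOfRate_lt (b : ℝ) : ∃ a, 5 / 2 < a ∧ logDetOfRate a < b := by
  have he := Real.exp_pos b
  -- The last shape is then `exp b`, so its term is at most `b - log (5/2) < b`, while the other
  -- terms are nonpositive.
  refine ⟨5 / 2 + Real.exp b, by linarith, ?_⟩
  set a := 5 / 2 + Real.exp b with ha
  have ha0 : 0 < a := by positivity
  have hle : ∀ m : Fin 6, meanLog (a - (m : ℕ) / 2) - Real.log a ≤
      if m = 5 then b - Real.log (5 / 2) else 0 := by
    intro m
    have hm := cast_fin_le m
    have hpos : 0 < a - (m : ℕ) / 2 := by linarith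
    have h1 := meanLog_le hpos
    split_ifs with h5
    · have h6 : a - (m : ℕ) / 2 = Real.exp b := by
        rw [h5, ha]
        norm_num
      rw [h6, Real.log_exp] at h1
      have : Real.log (5 / 2) ≤ Real.log a := Real.log_le_log (by norm_num) (by linarith)
      rw [h6]
      linarith
    · have h0 : (0 : ℝ) ≤ (m : ℕ) := Nat.cast_nonneg _
      have : Real.log (a - (m : ℕ) / 2) ≤ Real.log a := Real.log_le_log hpos (by linarith)
      linarith
  have h := Finset.sum_le_sum fun m (_ : m ∈ Finset.univ) => hle m
  rw [Finset.sum_ite_eq' Finset.univ (5 : Fin 6)] at h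
  simp only [Finset.mem_univ, if_true] at h
  have : 0 < Real.log (5 / 2) := Real.log_pos (by norm_num)
  unfold logDetOfRate
  linarith

lemma exists_lt_logDetOfRate {b : ℝ} (hb : b < 0) : ∃ a, 5 / 2 < a ∧ b < logDetOfRate a := by
  set e := Real.exp (b / 6) with he
  have he0 : 0 < e := Real.exp_pos _
  have he1 : e < 1 := by
    rw [he, Real.exp_lt_one_iff]
    linarith
  -- All arguments `a - m/2 - 1` are at least `a - 7/2`, and this choice gives `(a - 7/2) / a = (1 +
  -- e) / 2 > e`, so each of the six terms exceeds `b / 6`.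
  set a := 7 / (1 - e) with ha
  have h1e : 0 < 1 - e := by linarith
  have ha7 : 7 < a := by
    rw [ha, lt_div_iff₀ h1e]
    linarith
  refine ⟨a, by linarith, ?_⟩
  have hlog : b / 6 < Real.log (a - 7 / 2) - Real.log a := by
    rw [← Real.log_div (by linarith) (by linarith), Real.lt_log_iff_exp_lt
      (div_pos (by linarith) (by linarith)), ← he, lt_div_iff₀ (by linarith)]
    have : (1 - e) * a = 7 := by
      rw [ha]
      field_simp
    linarith
  have hle : ∀ m : Fin 6, b / 6 < meanLog (a - (m : ℕ) / 2) - Real.log a := by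
    intro m
    have hm := cast_fin_le m
    have h1 := le_meanLog (α := a - (m : ℕ) / 2) (by linarith)
    have h2 : Real.log (a - 7 / 2) ≤ Real.log (a - (m : ℕ) / 2 - 1) :=
      Real.log_le_log (by linarith) (by linarith)
    linarith
  have h := Finset.sum_lt_sum_of_nonempty (s := Finset.univ) Finset.univ_nonempty
    fun m _ => hle m
  unfold logDetOfRate
  refine lt_of_eq_of_lt ?_ h
  simp
  ring

/-- All negative values of `E log det C` are attained. -/
lemma exists_logDetMean_eq {b : ℝ} (hb : b < 0) :
    ∃ δ, 0 < δ ∧ 0 < alphaC δ 5 ∧ logDetMean δ = b := by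
  obtain ⟨a₁, ha₁, h₁⟩ := exists_logDetOfRate_lt b
  obtain ⟨a₂, ha₂, h₂⟩ := exists_lt_logDetOfRate hb
  -- Darboux's theorem on `(5/2, ∞)`, the range of rates for which all six shapes are positive. The
  -- resulting `δ` need not lie below `√(7/11)`.
  have hord := Set.ordConnected_Ioi (a := (5 / 2 : ℝ)) |>.image_hasDerivWithinAt
    fun x hx => (hasDerivAt_logDetOfRate hx).hasDerivWithinAt
  obtain ⟨a, ha, hab⟩ := hord.out ⟨a₁, ha₁, rfl⟩ ⟨a₂, ha₂, rfl⟩ ⟨h₁.le, h₂.le⟩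
  have ha : 5 / 2 < a := ha
  have ha0 : 0 < a := by linarith
  have hrate : rate (Real.sqrt (7 / (2 * a))) = a := by
    rw [rate, Real.sq_sqrt (by positivity)]
    field_simp
  refine ⟨Real.sqrt (7 / (2 * a)), by positivity, ?_, ?_⟩
  · rw [alphaC_eq, hrate]
    have h5 : (((5 : Fin 6) : ℕ) : ℝ) = 5 := by norm_num
    rw [h5]
    linarith
  · rw [logDetMean_eq, hrate, hab]

/-! ### Identification of the law from the level of fluctuations -/

/-- The gap between the two sides is a sum over the entries: `l² - 1 - log l²` on the diagonal and
`l²` off it. Each term is nonnegative, and all vanish only for the identity. -/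
lemma log_det_le_trace_gram {l : UT → ℝ} (hl : l ∈ cholCone) :
    Real.log ((upperMat l).transpose * upperMat l).det ≤
      ((upperMat l).transpose * upperMat l).trace - 6 ∧
    (Real.log ((upperMat l).transpose * upperMat l).det =
      ((upperMat l).transpose * upperMat l).trace - 6 → upperMat l = 1) := by
  have hnn : ∀ p : UT, 0 ≤ l p ^ 2 - if p.1.1 = p.1.2 then 1 + Real.log (l p ^ 2) else 0 := by
    intro p
    split_ifs with h
    · have hpos : 0 < l p := by
        rw [eq_diagIdx h]
        exact hl _
      have := Real.log_le_sub_one_of_pos (pow_pos hpos 2)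
      linarith
    · simpa using sq_nonneg (l p)
  have hd : ∑ p : UT, (if p.1.1 = p.1.2 then 1 + Real.log (l p ^ 2) else 0) =
      6 + Real.log ((upperMat l).transpose * upperMat l).det := by
    have h1 : ∀ p : UT, (if p.1.1 = p.1.2 then 1 + Real.log (l p ^ 2) else 0) =
        if p.1.1 = p.1.2 then 1 + Real.log (l (diagIdx p.1.1) ^ 2) else 0 := by
      intro p
      split_ifs with h
      · rw [← eq_diagIdx h]
      · rfl
    simp_rw [h1]
    have h2 := prod_UT_diag (M := Multiplicative ℝ) fun m =>
      Multiplicative.ofAdd (1 + Real.log (l (diagIdx m) ^ 2))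
    have h3 : ∑ p : UT, (if p.1.1 = p.1.2 then 1 + Real.log (l (diagIdx p.1.1) ^ 2) else 0) =
      ∑ m, (1 + Real.log (l (diagIdx m) ^ 2)) := h2
    rw [h3, log_det_gram hl, Finset.sum_add_distrib]
    simp
  have hsum : ∑ p : UT, (l p ^ 2 - if p.1.1 = p.1.2 then 1 + Real.log (l p ^ 2) else 0) =
      ((upperMat l).transpose * upperMat l).trace - 6 -
        Real.log ((upperMat l).transpose * upperMat l).det := by
    rw [Finset.sum_sub_distrib, hd, trace_gram]
    ring
  refine ⟨?_, fun h => ?_⟩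
  · have := Finset.sum_nonneg fun p (_ : p ∈ Finset.univ) => hnn p
    rw [hsum] at this
    linarith
  · rw [h, sub_self, Finset.sum_eq_zero_iff_of_nonneg fun p _ => hnn p] at hsum
    have hp : ∀ p : UT, l p = if p.1.1 = p.1.2 then 1 else 0 := by
      intro p
      have h0 := hsum p (Finset.mem_univ p)
      split_ifs with h
      · have hpos : 0 < l p := by
          rw [eq_diagIdx h]
          exact hl _
        rw [if_pos h] at h0
        by_contra hne
        have h1 := Real.log_lt_sub_one_of_pos (pow_pos hpos 2) (fun h' => hne (by
          exact (pow_eq_one_iff_of_nonneg hpos.le two_ne_zero).1 h'))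
        linarith
      · rw [if_neg h, sub_zero] at h0
        exact pow_eq_zero_iff two_ne_zero |>.1 h0
    ext m n
    rw [Matrix.one_apply]
    rcases le_or_gt m n with h | h
    · rw [upperMat_of_le _ h, hp]
    · rw [upperMat_of_lt _ h, if_neg h.ne']

lemma log_det_le_trace {C : M6} (hC : C.PosDef) :
    Real.log C.det ≤ C.trace - 6 ∧ (Real.log C.det = C.trace - 6 → C = 1) := by
  obtain ⟨l, hl, rfl⟩ := exists_gram_eq hC
  refine ⟨(log_det_le_trace_gram hl).1, fun h => ?_⟩
  rw [(log_det_le_trace_gram hl).2 h]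
  simp

lemma ae_posDef {b : ℝ} {q : M6 → ℝ} (hq : IsAdmissibleDensity b q) :
    ∀ᵐ C ∂densityLaw q, C.PosDef := by
  rw [densityLaw, ae_withDensity_iff hq.measurable.ennreal_ofReal]
  refine ae_of_all _ fun C h => ?_
  by_contra hC
  rw [hq.support C hC] at h
  simp at h

/-- The mean of `tr C - 6 - log det C ≥ 0` is `-b`. If it were zero, `C` would be the identity
almost surely and the level would be 0. -/
lemma logdet_neg {b δ : ℝ} (hδ : 0 < δ) {q : M6 → ℝ} (hq : IsAdmissibleDensity b q)
    (hlevel : HasFluctuationLevel (densityLaw q) (fun C => C) δ) : b < 0 := by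
  have := hq.prob
  have ht : Integrable (fun C : M6 => C.trace - 6) (densityLaw q) :=
    (integrable_trace hq).sub (integrable_const _)
  have hi : Integrable (fun C : M6 => C.trace - 6 - Real.log C.det) (densityLaw q) :=
    ht.sub hq.logdet_integrable
  have hint : ∫ C : M6, (C.trace - 6 - Real.log C.det) ∂densityLaw q = -b := by
    rw [integral_sub ht hq.logdet_integrable,
      integral_sub (integrable_trace hq) (integrable_const _), integral_trace hq, hq.logdet]
    simp
  have hnn : 0 ≤ᵐ[densityLaw q] fun C : M6 => C.trace - 6 - Real.log C.det := by
    filter_upwards [ae_posDef hq] with C hC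
    exact sub_nonneg.2 (log_det_le_trace hC).1
  have hb : b ≤ 0 := by
    have := integral_nonneg_of_ae hnn
    linarith
  refine hb.lt_of_ne fun hb0 => ?_
  rw [hb0, neg_zero, integral_eq_zero_iff_of_nonneg_ae hnn hi] at hint
  have hone : ∀ᵐ C ∂densityLaw q, frobSq (C - 1) = 0 := by
    filter_upwards [ae_posDef hq, hint] with C hC h
    have h' : C.trace - 6 - Real.log C.det = 0 := h
    rw [(log_det_le_trace hC).2 (by linarith)]
    simp [frobSq]
  have h2 := hlevel.2
  rw [integral_congr_ae (g := fun _ => (0 : ℝ)) hone] at h2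
  simp at h2
  exact hδ.ne' h2

/-- A density of maximal entropy with level of fluctuations `δ` is the explicit one. -/
lemma densityLaw_eq_of_level {b δ : ℝ} (hδ : 0 < δ) {q : M6 → ℝ} (hq : IsMaxEntDensity b q)
    (hlevel : HasFluctuationLevel (densityLaw q) (fun C => C) δ) :
    densityLaw q = densityLaw (pdfC δ) := by
  obtain ⟨δ', hδ', hα', rfl⟩ := exists_logDetMean_eq (logdet_neg hδ hq.1 hlevel)
  have h := densityLaw_eq_of_isMaxEntDensity hδ' hα' hq
  -- The law is now the explicit one for `δ'`, whose level is `δ'`; comparison with the given level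
  -- yields `δ' = δ`.
  have hl := (hasFluctuationLevel_pdfC hδ' hα').2
  rw [← h, ← hlevel.2] at hl
  rw [h, hl]

/-! ### The triangular representation -/

/-- The positive definite matrix `Lᵀ L` with `L` built from standard normal variables. -/
def gramFactor (δ : ℝ) (g : UT → ℝ) : M6 := (upperFactor δ g).transpose * upperFactor δ g

section Representation

variable {δ : ℝ}

lemma gramFactor_eq (δ : ℝ) :
    gramFactor δ = (fun l => (upperMat l).transpose * upperMat l) ∘ factorMap δ := by
  ext1 g
  simp [gramFactor, upperFactor_eq]

lemma factorMap_mem (hδ : 0 < δ) (hα : 0 < alphaC δ 5) (g : UT → ℝ) :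
    factorMap δ g ∈ cholCone := by
  intro m
  have h1 := sigmaC_pos hδ
  have h2 := hFun_pos (alphaC_pos hα m) (g (diagIdx m))
  simp only [factorMap, entryMap, diagIdx, if_true] at h2 ⊢
  positivity

lemma entryMap_injective (hδ : 0 < δ) (hα : 0 < alphaC δ 5) (p : UT) :
    Function.Injective (entryMap δ p) := by
  have hσ := sigmaC_pos hδ
  intro a b hab
  unfold entryMap at hab
  split_ifs at hab with h
  · have hα' := alphaC_pos hα p.1.1
    have h1 := mul_left_cancel₀ hσ.ne' hab
    have ha := hFun_pos hα' a
    have hb := hFun_pos hα' b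
    rw [Real.sqrt_inj (by positivity) (by positivity)] at h1
    exact (strictMono_hFun hα').injective (by linarith)
  · exact mul_left_cancel₀ hσ.ne' hab

lemma exists_factorMap_eq (hδ : 0 < δ) (hα : 0 < alphaC δ 5) {l : UT → ℝ} (hl : l ∈ cholCone) :
    ∃ g, factorMap δ g = l := by
  have hσ := sigmaC_pos hδ
  have h : ∀ p, ∃ x, entryMap δ p x = l p := by
    intro p
    by_cases hp : p.1.1 = p.1.2
    · have hpos : 0 < l p := by
        rw [eq_diagIdx hp]
        exact hl _
      obtain ⟨x, hx⟩ := exists_hFun_eq (alphaC_pos hα p.1.1)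
        (y := (l p / sigmaC δ) ^ 2 / 2) (by positivity)
      refine ⟨x, ?_⟩
      rw [entryMap, if_pos hp, hx, mul_div_cancel₀ _ two_ne_zero, Real.sqrt_sq (by positivity)]
      field_simp
    · refine ⟨l p / sigmaC δ, ?_⟩
      rw [entryMap, if_neg hp]
      field_simp
  choose g hg using h
  exact ⟨g, funext hg⟩

lemma measurable_gramFactor (hα : 0 < alphaC δ 5) : Measurable (gramFactor δ) := by
  rw [gramFactor_eq]
  exact measurable_gram.comp (measurable_factorMap hα)

lemma measurable_upperFactor (hα : 0 < alphaC δ 5) : Measurable (upperFactor δ) := by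
  rw [funext (upperFactor_eq δ)]
  exact measurable_of_entries fun m n => (measurable_upperMat m n).comp (measurable_factorMap hα)

lemma posDef_gramFactor (hδ : 0 < δ) (hα : 0 < alphaC δ 5) (g : UT → ℝ) :
    (gramFactor δ g).PosDef := by
  rw [gramFactor_eq]
  exact posDef_gram (factorMap_mem hδ hα g)

lemma exists_gramFactor_eq (hδ : 0 < δ) (hα : 0 < alphaC δ 5) {C : M6} (hC : C.PosDef) :
    ∃ g, gramFactor δ g = C := by
  obtain ⟨l, hl, rfl⟩ := exists_gram_eq hC
  obtain ⟨g, rfl⟩ := exists_factorMap_eq hδ hα hl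
  exact ⟨g, by rw [gramFactor_eq]; rfl⟩

lemma gramFactor_injective (hδ : 0 < δ) (hα : 0 < alphaC δ 5) :
    Function.Injective (gramFactor δ) := by
  intro g g' h
  rw [gramFactor_eq] at h
  simp only [Function.comp_apply, ← symOf_gramUpper] at h
  have h1 := injOn_gramUpper (factorMap_mem hδ hα g) (factorMap_mem hδ hα g') (symOf_injective h)
  ext p
  exact entryMap_injective hδ hα p (congrFun h1 p)

/-- Lusin–Souslin again; what is needed is a measurable inverse, to recover the normals from the
matrix. -/
lemma measurableEmbedding_gramFactor (hδ : 0 < δ) (hα : 0 < alphaC δ 5) :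
    MeasurableEmbedding (gramFactor δ) := by
  have : MeasurableSpace.CountablySeparated M6 :=
    inferInstanceAs (MeasurableSpace.CountablySeparated (Fin 6 → Fin 6 → ℝ))
  exact (measurable_gramFactor hα).measurableEmbedding (gramFactor_injective hδ hα)

lemma map_gramFactor (hδ : 0 < δ) (hα : 0 < alphaC δ 5) :
    stdNormal.map (gramFactor δ) = densityLaw (pdfC δ) := by
  rw [gramFactor_eq, ← Measure.map_map measurable_gram (measurable_factorMap hα),
    map_factorMap hδ hα, map_gram_factorLaw hδ hα]

variable {Ω : Type*} [MeasurableSpace Ω] {P : Measure Ω}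

lemma upperFactor_apply_le (δ : ℝ) (g : UT → ℝ) (p : UT) :
    upperFactor δ g p.1.1 p.1.2 = entryMap δ p (g p) := by
  rw [upperFactor_eq, upperMat_of_le _ p.2]
  rfl

lemma isTriangularRepresentation_gramFactor (hα : 0 < alphaC δ 5) {G : UT → Ω → ℝ}
    (hG : ∀ i, Measurable (G i)) (hlaw : ∀ i, HasLaw (G i) (gaussianReal 0 1) P)
    (hind : iIndepFun G P) :
    IsTriangularRepresentation P δ (fun ω => gramFactor δ fun i => G i ω)
      (fun ω => upperFactor δ fun i => G i ω) G where
  factorization _ := rfl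
  measurable := (measurable_upperFactor hα).comp (measurable_pi_lambda _ hG)
  upper ω m n h := by
    rw [upperFactor_eq, upperMat_of_lt _ h]
  indep := by
    simp_rw [upperFactor_apply_le]
    exact hind.comp (fun i => entryMap δ i) fun i => measurable_entryMap hα i
  off_diagonal m n hmn ω := by
    have := upperFactor_apply_le δ (fun i => G i ω) ⟨(m, n), hmn.le⟩
    simpa [entryMap, hmn.ne] using this
  diagonal m ω := by
    have := upperFactor_apply_le δ (fun i => G i ω) ⟨(m, m), le_rfl⟩
    simpa only [entryMap, if_true] using this
  gaussian_measurable := hG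
  gaussian := hlaw
  gaussian_indep := hind

lemma hasLaw_stdNormal_iff [IsProbabilityMeasure P] {G : UT → Ω → ℝ}
    (hG : ∀ i, Measurable (G i)) : P.map (fun ω i => G i ω) = stdNormal ↔
      (∀ i, HasLaw (G i) (gaussianReal 0 1) P) ∧ iIndepFun G P := by
  constructor
  · intro h
    have hl : ∀ i, HasLaw (G i) (gaussianReal 0 1) P := by
      intro i
      refine ⟨(hG i).aemeasurable, ?_⟩
      have h1 : G i = (fun g : UT → ℝ => g i) ∘ fun ω i => G i ω := rfl
      rw [h1, ← Measure.map_map (measurable_pi_apply i) (measurable_pi_lambda _ hG), h, stdNormal]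
      exact (measurePreserving_eval (fun _ : UT => gaussianReal 0 1) i).map_eq
    refine ⟨hl, ?_⟩
    rw [iIndepFun_iff_map_fun_eq_pi_map fun i => (hG i).aemeasurable, h, stdNormal]
    congr 1
    ext1 i
    rw [(hl i).map_eq]
  · rintro ⟨hl, hi⟩
    rw [(iIndepFun_iff_map_fun_eq_pi_map fun i => (hG i).aemeasurable).1 hi, stdNormal]
    congr 1
    ext1 i
    rw [(hl i).map_eq]

/-- Every positive definite random matrix with the explicit law has a triangular representation. -/
lemma exists_isTriangularRepresentation [IsProbabilityMeasure P] (hδ : 0 < δ)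
    (hα : 0 < alphaC δ 5) {X : Ω → M6} (hX : Measurable X) (hpd : ∀ ω, (X ω).PosDef)
    (hlaw : P.map X = densityLaw (pdfC δ)) :
    ∃ (L : Ω → M6) (G : UT → Ω → ℝ), IsTriangularRepresentation P δ X L G := by
  have hemb := measurableEmbedding_gramFactor hδ hα
  -- The normals are functions of `X` itself, so the probability space need not be enlarged and the
  -- factorization holds at every `ω`.
  set G : UT → Ω → ℝ := fun i ω => hemb.invFun (X ω) i with hGdef
  have hGm : ∀ i, Measurable (G i) := fun i =>
    (measurable_pi_apply i).comp (hemb.measurable_invFun.comp hX)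
  have hXG : X = fun ω => gramFactor δ fun i => G i ω := by
    ext1 ω
    obtain ⟨g, hg⟩ := exists_gramFactor_eq hδ hα (hpd ω)
    have h1 : (fun i => G i ω) = g := by
      change hemb.invFun (X ω) = g
      rw [← hg]
      exact hemb.leftInverse_invFun g
    rw [h1, hg]
  have hmap : P.map (fun ω i => G i ω) = stdNormal := by
    have h1 : (fun ω i => G i ω) = hemb.invFun ∘ X := rfl
    rw [h1, ← Measure.map_map hemb.measurable_invFun hX, hlaw, ← map_gramFactor hδ hα,
      Measure.map_map hemb.measurable_invFun hemb.measurable, hemb.leftInverse_invFun.comp_eq_id,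
      Measure.map_id]
  obtain ⟨h1, h2⟩ := (hasLaw_stdNormal_iff hGm).1 hmap
  refine ⟨fun ω => upperFactor δ fun i => G i ω, G, ?_⟩
  have h3 := isTriangularRepresentation_gramFactor hα hGm h1 h2
  rw [← hXG] at h3
  exact h3

/-! ### Random fields -/

lemma hasFluctuationLevel_iff {X : Ω → M6} (hX : Measurable X) {δ : ℝ} :
    HasFluctuationLevel P X δ ↔ HasFluctuationLevel (P.map X) (fun C => C) δ := by
  unfold HasFluctuationLevel
  rw [integrable_map_measure measurable_frobSq_sub_one.aestronglyMeasurable hX.aemeasurable,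
    integral_map hX.aemeasurable measurable_frobSq_sub_one.aestronglyMeasurable]
  rfl

lemma IsNormalizedGaussianField.hasLaw {G : E3 → Ω → ℝ} (hG : IsNormalizedGaussianField P G)
    (x : E3) : HasLaw (G x) (gaussianReal 0 1) P := by
  refine ⟨(hG.measurable x).aemeasurable, ?_⟩
  rw [(hG.gaussian.hasGaussianLaw_eval x).map_eq_gaussianReal, hG.mean x,
    variance_eq_integral (hG.measurable x).aemeasurable, hG.mean x]
  simp [hG.second_moment x]

variable {Ω₀ : Type*} [MeasurableSpace Ω₀] {P₀ : Measure Ω₀}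

lemma AreIndependentCopies.hasLaw {ι : Type*} {G : ι → E3 → Ω → ℝ} {G₀ : E3 → Ω₀ → ℝ}
    (hG : AreIndependentCopies P P₀ G G₀) (hG₀ : IsNormalizedGaussianField P₀ G₀) (i : ι)
    (x : E3) : HasLaw (G i x) (gaussianReal 0 1) P := by
  refine ⟨(hG.measurable i x).aemeasurable, ?_⟩
  rw [← (hG₀.hasLaw x).map_eq]
  exact ((hG.copies i).comp (measurable_pi_apply x)).map_eq

lemma AreIndependentCopies.iIndepFun_eval {ι : Type*} {G : ι → E3 → Ω → ℝ} {G₀ : E3 → Ω₀ → ℝ}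
    (hG : AreIndependentCopies P P₀ G G₀) (x : E3) : iIndepFun (fun i => G i x) P :=
  hG.indep.comp (fun _ f => f x) fun _ => measurable_pi_apply x

/-- Homogeneity of the matrix field requires invariance of the joint law of all the fields;
independence reduces it to each field separately. -/
lemma AreIndependentCopies.identDistrib_shift [IsProbabilityMeasure P] {ι : Type*} [Countable ι]
    {G : ι → E3 → Ω → ℝ} {G₀ : E3 → Ω₀ → ℝ} (hG : AreIndependentCopies P P₀ G G₀)
    (hG₀ : IsHomogeneous P₀ G₀) (t : E3) :
    IdentDistrib (fun ω i x => G i (x + t) ω) (fun ω i x => G i x ω) P P := by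
  have hshift : Measurable fun (f : E3 → ℝ) x => f (x + t) :=
    measurable_pi_lambda _ fun x => measurable_pi_apply (x + t)
  refine IdentDistrib.pi (fun i => ?_) ?_ hG.indep
  · exact (((hG.copies i).comp hshift).trans (hG₀ t)).trans (hG.copies i).symm
  · exact hG.indep.comp (fun _ (f : E3 → ℝ) x => f (x + t)) fun _ => hshift

/-- One product space with 21 factors serves every `s` at once: the `i`-th copy reads the `i`-th
coordinate. -/
lemma exists_areIndependentCopies [IsProbabilityMeasure P₀] {S : Type*} {G₀ : S → E3 → Ω₀ → ℝ}
    (hG₀ : ∀ s, IsNormalizedGaussianField P₀ (G₀ s)) (s : S) :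
    AreIndependentCopies (Measure.pi fun _ : UT => P₀) P₀ (fun i x ω => G₀ s x (ω i)) (G₀ s) where
  measurable i x := ((hG₀ s).measurable x).comp (measurable_pi_apply i)
  copies i := by
    have hm : Measurable fun ω x => G₀ s x ω := measurable_pi_lambda _ (hG₀ s).measurable
    refine ⟨(hm.comp (measurable_pi_apply i)).aemeasurable, hm.aemeasurable, ?_⟩
    have h := (measurePreserving_eval (fun _ : UT => P₀) i).map_eq
    conv_rhs => rw [← h, Measure.map_map hm (measurable_pi_apply i)]
    rfl
  indep := iIndepFun_pi (μ := fun _ : UT => P₀) (X := fun _ ω x => G₀ s x ω)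
    fun _ => (measurable_pi_lambda _ (hG₀ s).measurable).aemeasurable

lemma isMaxEntField_gramFactor [IsProbabilityMeasure P] {S : Type*} (hδ : 0 < δ)
    (hα : 0 < alphaC δ 5) {G₀ : S → E3 → Ω₀ → ℝ}
    (hG₀ : ∀ s, IsNormalizedGaussianField P₀ (G₀ s)) {G : UT → S → E3 → Ω → ℝ}
    (hG : ∀ s, AreIndependentCopies P P₀ (fun i => G i s) (G₀ s)) :
    IsMaxEntField P (logDetMean δ) δ fun s x ω => gramFactor δ fun i => G i s x ω := by
  have hm : ∀ s x, Measurable fun ω => gramFactor δ fun i => G i s x ω := fun s x =>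
    (measurable_gramFactor hα).comp (measurable_pi_lambda _ fun i => (hG s).measurable i x)
  have hlaw : ∀ s x, P.map (fun ω => gramFactor δ fun i => G i s x ω) = densityLaw (pdfC δ) := by
    intro s x
    have h := (hasLaw_stdNormal_iff (G := fun i => G i s x) fun i => (hG s).measurable i x).2
      ⟨fun i => (hG s).hasLaw (hG₀ s) i x, (hG s).iIndepFun_eval x⟩
    rw [← map_gramFactor hδ hα, ← h, Measure.map_map (measurable_gramFactor hα)
      (measurable_pi_lambda _ fun i => (hG s).measurable i x)]
    rfl
  exact {
    measurable := hm
    posDef := fun s x ω => posDef_gramFactor hδ hα _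
    homogeneous := fun s t => by
      -- The matrix field is a pointwise function of the 21 fields, so it commutes with translations
      -- and inherits their joint invariance.
      have hΦ : Measurable fun (f : UT → E3 → ℝ) (x : E3) => gramFactor δ fun i => f i x :=
        measurable_pi_lambda _ fun x => (measurable_gramFactor hα).comp
          (measurable_pi_lambda _ fun i => (measurable_pi_apply x).comp (measurable_pi_apply i))
      exact ((hG s).identDistrib_shift (hG₀ s).homogeneous t).comp hΦ
    maxEnt := fun s x => ⟨pdfC δ, isMaxEntDensity_pdfC hδ hα, hlaw s x⟩
    level := fun s x => by
      rw [hasFluctuationLevel_iff (hm s x), hlaw s x]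
      exact hasFluctuationLevel_pdfC hδ hα }

end Representation

/-! ### Order and lower bound of the shape parameters -/

lemma alphaC_strictAnti (δ : ℝ) {m n : Fin 6} (h : m < n) : alphaC δ n < alphaC δ m := by
  rw [alphaC_eq, alphaC_eq]
  have : ((m : ℕ) : ℝ) < (n : ℕ) := by exact_mod_cast h
  linarith

lemma three_lt_alphaC {δ : ℝ} (hδ_pos : 0 < δ) (hδ_lt : δ < Real.sqrt (7 / 11)) :
    3 < alphaC δ 5 := by
  have h1 : δ ^ 2 < 7 / 11 := (Real.lt_sqrt hδ_pos.le).1 hδ_lt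
  -- The threshold `√(7/11)` is exactly where the rate equals `11/2` and the last shape, `rate δ -
  -- 5/2`, equals 3.
  have h2 : 11 / 2 < rate δ := by
    rw [rate, lt_div_iff₀ (by positivity)]
    linarith
  have h5 : (((5 : Fin 6) : ℕ) : ℝ) = 5 := by norm_num
  rw [alphaC_eq, h5]
  linarith

end RandomElasticity

end

theorem proposition1 {Ω : Type u} [MeasurableSpace Ω] (P : Measure Ω)
    [IsProbabilityMeasure P] {S : Type v} (δ : ℝ) (hδ_pos : 0 < δ)
    (hδ_lt : δ < Real.sqrt (7 / 11)) :
    -- the parameters and the function `h` of the representation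
    ((∀ m n : Fin 6, m < n → alphaC δ n < alphaC δ m) ∧ 3 < alphaC δ 5) ∧
    (∀ α : ℝ, 0 < α → HasLaw (hFun α) (gammaMeasure α 1) (gaussianReal 0 1)) ∧
    ∃ b : ℝ,
      -- the explicit density solves the maximum entropy problem, at the level `δ`,
      -- and the inverse matrix is of second order
      (IsMaxEntDensity b (pdfC δ) ∧
        HasFluctuationLevel (densityLaw (pdfC δ)) (fun C => C) δ ∧
        Integrable (fun C : M6 => frobSq C⁻¹) (densityLaw (pdfC δ))) ∧
      -- every maximum entropy field of level `δ` has this marginal density at every point, and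
      -- the triangular representation
      (∀ (b' : ℝ) (C : S → E3 → Ω → M6), IsMaxEntField P b' δ C → ∀ s x,
        P.map (C s x) = densityLaw (pdfC δ) ∧
        ∃ (L : Ω → M6) (G : UT → Ω → ℝ), IsTriangularRepresentation P δ (C s x) L G) ∧
      -- for all spatial correlation structures `G₀(·; s)`, independent copies exist, and every
      -- family of independent copies yields a maximum entropy field of level `δ` through the
      -- triangular representation
      (∀ {Ω₀ : Type w} [MeasurableSpace Ω₀] (P₀ : Measure Ω₀) [IsProbabilityMeasure P₀]
        (G₀ : S → E3 → Ω₀ → ℝ), (∀ s, IsNormalizedGaussianField P₀ (G₀ s)) →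
        (∃ (Ω₁ : Type w) (_ : MeasurableSpace Ω₁) (P₁ : Measure Ω₁) (_ : IsProbabilityMeasure P₁)
          (G : UT → S → E3 → Ω₁ → ℝ),
          ∀ s, AreIndependentCopies P₁ P₀ (fun i => G i s) (G₀ s)) ∧
        (∀ G : UT → S → E3 → Ω → ℝ,
          (∀ s, AreIndependentCopies P P₀ (fun i => G i s) (G₀ s)) →
          IsMaxEntField P b δ (fun s x ω =>
            (upperFactor δ fun i => G i s x ω).transpose * upperFactor δ fun i => G i s x ω) ∧
          ∀ s x, IsTriangularRepresentation P δ
            (fun ω =>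
              (upperFactor δ fun i => G i s x ω).transpose * upperFactor δ fun i => G i s x ω)
            (fun ω => upperFactor δ fun i => G i s x ω) (fun i => G i s x))) := by
  have h3 := three_lt_alphaC hδ_pos hδ_lt
  -- Positivity of the last shape suffices for the law, the representation and the entropy; only the
  -- inverse moment uses more, namely a last shape above 2.
  have hα : 0 < alphaC δ 5 := by linarith
  refine ⟨⟨fun m n h => alphaC_strictAnti δ h, h3⟩, fun α hα' => hasLaw_hFun hα', logDetMean δ,
    ⟨isMaxEntDensity_pdfC hδ_pos hα, hasFluctuationLevel_pdfC hδ_pos hα,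
      integrable_frobSq_inv_pdfC hδ_pos (by linarith)⟩, ?_, ?_⟩
  · intro b' C hC s x
    obtain ⟨q, hq, hlaw⟩ := hC.maxEnt s x
    have hlevel := hC.level s x
    rw [hasFluctuationLevel_iff (hC.measurable s x), hlaw] at hlevel
    have h := hlaw.trans (densityLaw_eq_of_level hδ_pos hq hlevel)
    exact ⟨h, exists_isTriangularRepresentation hδ_pos hα (hC.measurable s x) (hC.posDef s x) h⟩
  · intro Ω₀ _ P₀ _ G₀ hG₀
    refine ⟨⟨UT → Ω₀, inferInstance, Measure.pi fun _ => P₀, inferInstance,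
      fun i s x ω => G₀ s x (ω i), fun s => exists_areIndependentCopies hG₀ s⟩, fun G hG => ?_⟩
    exact ⟨isMaxEntField_gramFactor hδ_pos hα hG₀ hG, fun s x =>
      isTriangularRepresentation_gramFactor hα (fun i => (hG s).measurable i x)
        (fun i => (hG s).hasLaw (hG₀ s) i x) ((hG s).iIndepFun_eval x)⟩
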